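/- **Setting.** Let $\widetilde M$ be a smooth manifold of dimension $2m+1$ with an almost contact metric structure $(\phi,\xi,\eta,\widetilde g)$, i.e. $\phi^2=-I+\eta\otimes\xi$, $\phi\xi=0$, $\eta\circ\phi=0$, $\eta(\xi)=1$, $\widetilde g(\phi X,\phi Y)=\widetilde g(X,Y)-\eta(X)\eta(Y)$, which is trans-Sasakian of type $(\alpha,\beta)$: $\alpha,\beta\in C^\infty(\widetilde M)$ and $$(\widetilde\nabla_X\phi)Y=\alpha\,(\widetilde g(X,Y)\xi-\eta(Y)X)+\beta\,(\widetilde g(\phi X,Y)\xi-\eta(Y)\phi X),$$ where $\widetilde\nabla$ is the Levi-Civita connection. Type $(0,\beta)$ is called $\beta$-Kenmotsu. Let $(N^\top,g_\top)$, $(N^\bot,g_\bot)$ be connected Riemannian manifolds, $f_1:N^\top\to(0,\infty)$ and $f_2:N^\bot\to(0,\infty)$ smooth functions, and let the doubly warped product $M={}_{f_2}N^\top\times_{f_1}N^\bot$, that is $N^\top\times N^\bot$ with the metric $f_2^2g_\top\oplus f_1^2g_\bot$, be isometrically immersed in $\widetilde M$, with $\xi$ tangent to $M$, as a contact CR-submanifold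 with $\mathcal D=TN^\top$ and $\mathcal D^\bot=TN^\bot$: $\phi\mathcal D\subset\mathcal D$, and $\phi\mathcal D^\bot$ is normal to $M$. **Theorem 1.** There is no proper doubly warped product contact CR-submanifold of a trans-Sasakian manifold: $f_1$ and $f_2$ cannot both be non-constant. Moreover, $\xi$ is tangent to $N^\top$ everywhere on $M$ or tangent to $N^\bot$ everywhere on $M$, and: 1. If $\xi$ is tangent to $N^\top$, then $f_2$ is constant and, when $\dim N^\bot>0$, $\xi(\ln f_1)=\beta$ on $M$ and $\beta|_M$ is (the pull-back of) a smooth function on $N^\top$. 2. If $\xi$ is tangent to $N^\bot$, then $f_1$ is constant and, when $\dim\mathcal D=\dim N^\top>0$, on $M$ one has $\alpha=0$ and $\beta=\xi(\ln f_2)$, and $\beta|_M$ is (the pull-back of) a smooth function on $N^\bot$. If moreover $\widetilde M$ is connected and $\dim\widetilde M\ge 5$, then $\alpha=0$ on all of $\widetilde M$, so the ambient manifold is $\beta$-Kenmotsu. -/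

import Mathlib

open scoped Manifold ContDiff

noncomputable section

namespace DoublyWarpedCR

section Ambient

variable {E : Type*} [NormedAddCommGroup E] [NormedSpace ℝ E]
  {H : Type*} [TopologicalSpace H] {I : ModelWithCorners ℝ E H}
  {M : Type*} [TopologicalSpace M] [ChartedSpace H M] [IsManifold I ∞ M]

/-- A (smooth) Riemannian metric on the manifold `M`; the value of `g` on two tangent vectors `u`,
`v` at `p` is `g.inner p u v`. -/
abbrev RiemMetric {E : Type*} [NormedAddCommGroup E] [NormedSpace ℝ E]
    {H : Type*} [TopologicalSpace H] (I : ModelWithCorners ℝ E H)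
    (M : Type*) [TopologicalSpace M] [ChartedSpace H M] [IsManifold I ∞ M] : Type _ :=
  Bundle.ContMDiffRiemannianMetric I ∞ E (fun p : M => TangentSpace I p)

/-- `cov` is the Levi-Civita connection of the Riemannian metric `g`: it is compatible with the
metric, `v g(Y, Z) = g(∇_v Y, Z) + g(Y, ∇_v Z)` for vector fields `Y`, `Z` that are differentiable
at `p` and `v` in the tangent space at `p`, and it is torsion-free. (In Mathlib's convention
`cov Y p v` is the value at `p` of `∇_v Y`.) -/
structure IsLeviCivita [FiniteDimensional ℝ E] (g : RiemMetric I M)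
    (cov : CovariantDerivative I E (TangentSpace I : M → Type _)) : Prop where
  metric : ∀ (Y Z : ∀ p : M, TangentSpace I p) (p : M),
    MDifferentiableAt I (I.prod 𝓘(ℝ, E))
      (fun q => Bundle.TotalSpace.mk' E (E := fun q : M => TangentSpace I q) q (Y q)) p →
    MDifferentiableAt I (I.prod 𝓘(ℝ, E))
      (fun q => Bundle.TotalSpace.mk' E (E := fun q : M => TangentSpace I q) q (Z q)) p →
    ∀ v : TangentSpace I p,
      mvfderiv I (fun q => g.inner q (Y q) (Z q)) p v =
        g.inner p (cov Y p v) (Z p) + g.inner p (Y p) (cov Z p v)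
  torsion_free : cov.torsion = 0

/-- An almost contact metric structure `(φ, ξ, η, g)` on `M` with given Riemannian metric `g`:
smooth tensor fields `φ`, `ξ`, `η` of types `(1,1)`, `(1,0)`, `(0,1)` with
`φ² = -I + η ⊗ ξ`, `φ ξ = 0`, `η ∘ φ = 0`, `η(ξ) = 1` and
`g(φX, φY) = g(X, Y) - η(X) η(Y)`. -/
structure AlmostContactMetric (g : RiemMetric I M) where
  phi : ∀ p : M, TangentSpace I p →L[ℝ] TangentSpace I p
  xi : ∀ p : M, TangentSpace I p
  eta : ∀ p : M, TangentSpace I p →L[ℝ] ℝ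
  smooth_phi : ContMDiff I (I.prod 𝓘(ℝ, E →L[ℝ] E)) ∞
    (fun p => Bundle.TotalSpace.mk' (E →L[ℝ] E)
      (E := fun p : M => TangentSpace I p →L[ℝ] TangentSpace I p) p (phi p))
  smooth_xi : ContMDiff I (I.prod 𝓘(ℝ, E)) ∞
    (fun p => Bundle.TotalSpace.mk' E (E := fun p : M => TangentSpace I p) p (xi p))
  smooth_eta : ContMDiff I (I.prod 𝓘(ℝ, E →L[ℝ] ℝ)) ∞
    (fun p => Bundle.TotalSpace.mk' (E →L[ℝ] ℝ)
      (E := fun p : M => TangentSpace I p →L[ℝ] ℝ) p (eta p))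
  phi_phi : ∀ (p : M) (u : TangentSpace I p), phi p (phi p u) = -u + eta p u • xi p
  phi_xi : ∀ p : M, phi p (xi p) = 0
  eta_phi : ∀ (p : M) (u : TangentSpace I p), eta p (phi p u) = 0
  eta_xi : ∀ p : M, eta p (xi p) = 1
  inner_phi_phi : ∀ (p : M) (u v : TangentSpace I p),
    g.inner p (phi p u) (phi p v) = g.inner p u v - eta p u * eta p v

variable {g : RiemMetric I M}

/-- The almost contact metric structure `S` is trans-Sasakian of type `(α, β)`
(`cov` being the Levi-Civita connection): `α`, `β` are smooth functions and
`(∇_X φ) Y = α (g(X, Y) ξ - η(Y) X) + β (g(φ X, Y) ξ - η(Y) φ X)`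
for all smooth vector fields `Y` and all tangent vectors `X`,
where `(∇_X φ) Y = ∇_X (φ Y) - φ (∇_X Y)`. -/
structure IsTransSasakian (S : AlmostContactMetric g)
    (cov : CovariantDerivative I E (TangentSpace I : M → Type _)) (α β : M → ℝ) : Prop where
  smooth_alpha : ContMDiff I 𝓘(ℝ, ℝ) ∞ α
  smooth_beta : ContMDiff I 𝓘(ℝ, ℝ) ∞ β
  nabla_phi : ∀ Y : (∀ p : M, TangentSpace I p),
    ContMDiff I (I.prod 𝓘(ℝ, E)) ∞
      (fun p => Bundle.TotalSpace.mk' E (E := fun p : M => TangentSpace I p) p (Y p)) →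
    ∀ (p : M) (v : TangentSpace I p),
      cov (fun q => S.phi q (Y q)) p v - S.phi p (cov Y p v) =
        α p • (g.inner p v (Y p) • S.xi p - S.eta p (Y p) • v) +
        β p • (g.inner p (S.phi p v) (Y p) • S.xi p - S.eta p (Y p) • S.phi p v)

/-- `β`-Kenmotsu structures are the trans-Sasakian structures of type `(0, β)`. -/
def IsBetaKenmotsu (S : AlmostContactMetric g)
    (cov : CovariantDerivative I E (TangentSpace I : M → Type _)) (β : M → ℝ) : Prop :=
  IsTransSasakian S cov (fun _ => 0) β

end Ambient

section Product

variable {E₁ : Type*} [NormedAddCommGroup E₁] [NormedSpace ℝ E₁]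
  {H₁ : Type*} [TopologicalSpace H₁] {I₁ : ModelWithCorners ℝ E₁ H₁}
  {N₁ : Type*} [TopologicalSpace N₁] [ChartedSpace H₁ N₁]
  {E₂ : Type*} [NormedAddCommGroup E₂] [NormedSpace ℝ E₂]
  {H₂ : Type*} [TopologicalSpace H₂] {I₂ : ModelWithCorners ℝ E₂ H₂}
  {N₂ : Type*} [TopologicalSpace N₂] [ChartedSpace H₂ N₂]

variable (I₁ I₂) in
/-- The distribution on `N₁ × N₂` tangent to the first factor. -/
def tangentFst (p : N₁ × N₂) : Submodule ℝ (TangentSpace (I₁.prod I₂) p) :=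
  (mfderiv (I₁.prod I₂) I₂ (Prod.snd : N₁ × N₂ → N₂) p).ker

variable (I₁ I₂) in
/-- The distribution on `N₁ × N₂` tangent to the second factor. -/
def tangentSnd (p : N₁ × N₂) : Submodule ℝ (TangentSpace (I₁.prod I₂) p) :=
  (mfderiv (I₁.prod I₂) I₁ (Prod.fst : N₁ × N₂ → N₁) p).ker

variable [IsManifold I₁ ∞ N₁] [IsManifold I₂ ∞ N₂]

/-- The doubly warped product metric `f₂² g₁ ⊕ f₁² g₂` on `N₁ × N₂`, where
`f₁` is a function on `N₁` and `f₂` a function on `N₂`. -/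
def doublyWarpedInner (g₁ : RiemMetric I₁ N₁) (g₂ : RiemMetric I₂ N₂)
    (f₁ : N₁ → ℝ) (f₂ : N₂ → ℝ) (p : N₁ × N₂) (u v : TangentSpace (I₁.prod I₂) p) : ℝ :=
  (f₂ p.2) ^ 2 *
      g₁.inner p.1 (mfderiv (I₁.prod I₂) I₁ (Prod.fst : N₁ × N₂ → N₁) p u)
        (mfderiv (I₁.prod I₂) I₁ (Prod.fst : N₁ × N₂ → N₁) p v) +
    (f₁ p.1) ^ 2 *
      g₂.inner p.2 (mfderiv (I₁.prod I₂) I₂ (Prod.snd : N₁ × N₂ → N₂) p u)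
        (mfderiv (I₁.prod I₂) I₂ (Prod.snd : N₁ × N₂ → N₂) p v)

variable {E : Type*} [NormedAddCommGroup E] [NormedSpace ℝ E]
  {H : Type*} [TopologicalSpace H] {I : ModelWithCorners ℝ E H}
  {M : Type*} [TopologicalSpace M] [ChartedSpace H M] [IsManifold I ∞ M]
  {g : RiemMetric I M}

/-- `ι` exhibits the doubly warped product `_{f₂}N₁ ×_{f₁} N₂` (with smooth warping functions
`f₁ : N₁ → (0, ∞)`, `f₂ : N₂ → (0, ∞)`) as an isometrically immersed submanifold of `(M, g)`,
tangent to `ξ`, which is a contact CR-submanifold whose `φ`-invariant distribution is tangent to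
`N₁` and whose `φ`-anti-invariant distribution is tangent to `N₂`. (A smooth map that preserves the
positive definite metrics is an immersion, and the two distributions are orthogonal
complements of each other for `doublyWarpedInner`.) -/
structure IsDoublyWarpedContactCR (S : AlmostContactMetric g)
    (g₁ : RiemMetric I₁ N₁) (g₂ : RiemMetric I₂ N₂)
    (f₁ : N₁ → ℝ) (f₂ : N₂ → ℝ) (ι : N₁ × N₂ → M) : Prop where
  smooth_f₁ : ContMDiff I₁ 𝓘(ℝ, ℝ) ∞ f₁
  smooth_f₂ : ContMDiff I₂ 𝓘(ℝ, ℝ) ∞ f₂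
  pos_f₁ : ∀ x, 0 < f₁ x
  pos_f₂ : ∀ y, 0 < f₂ y
  smooth_map : ContMDiff (I₁.prod I₂) I ∞ ι
  isometric : ∀ (p : N₁ × N₂) (u v : TangentSpace (I₁.prod I₂) p),
    g.inner (ι p) (mfderiv (I₁.prod I₂) I ι p u) (mfderiv (I₁.prod I₂) I ι p v) =
      doublyWarpedInner g₁ g₂ f₁ f₂ p u v
  xi_tangent : ∀ p : N₁ × N₂, ∃ w : TangentSpace (I₁.prod I₂) p,
    mfderiv (I₁.prod I₂) I ι p w = S.xi (ι p)
  invariant : ∀ p : N₁ × N₂, ∀ u ∈ tangentFst I₁ I₂ p, ∃ u' ∈ tangentFst I₁ I₂ p,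
    S.phi (ι p) (mfderiv (I₁.prod I₂) I ι p u) = mfderiv (I₁.prod I₂) I ι p u'
  antiInvariant : ∀ p : N₁ × N₂, ∀ u ∈ tangentSnd I₁ I₂ p,
    ∀ v : TangentSpace (I₁.prod I₂) p,
      g.inner (ι p) (S.phi (ι p) (mfderiv (I₁.prod I₂) I ι p u))
        (mfderiv (I₁.prod I₂) I ι p v) = 0

variable (I₁ I₂)

/-- Along `ι`, the vector field `ξ` is tangent to the first factor. -/
def XiTangentFst (S : AlmostContactMetric g) (ι : N₁ × N₂ → M) : Prop :=
  ∀ p : N₁ × N₂, ∃ w ∈ tangentFst I₁ I₂ p, mfderiv (I₁.prod I₂) I ι p w = S.xi (ι p)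

/-- Along `ι`, the vector field `ξ` is tangent to the second factor. -/
def XiTangentSnd (S : AlmostContactMetric g) (ι : N₁ × N₂ → M) : Prop :=
  ∀ p : N₁ × N₂, ∃ w ∈ tangentSnd I₁ I₂ p, mfderiv (I₁.prod I₂) I ι p w = S.xi (ι p)

end Product

/-- `f` is a constant function. -/
def IsConst {X : Type*} (f : X → ℝ) : Prop := ∃ c : ℝ, ∀ x, f x = c

end DoublyWarpedCR

end

/-! Everything follows from the covariant derivative of `η`. The trans-Sasakian condition applied to
`ξ` gives `∇_X ξ = -α φX + β (X - η(X) ξ)`, hence `(∇_X η)(Y) = -α g(φX, Y) + β (g(X, Y) - η(X)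
η(Y))` (`cov_xi`, `koszul_eta`). Writing the left side with the Koszul formula leaves only
derivatives of `η` and `g`, and since `ξ` is tangent to the submanifold this identity pulls back
along the immersion with no second fundamental form (`koszul_eta_pullback`).

Let `ξ` be tangent to the first factor. In a product chart `η` vanishes on the second factor, the
metric is block diagonal, and `φ` maps each factor orthogonally to the other. The identity on mixed
pairs `(X, Z)` then says that `f₂` has zero derivative and that `η(X)` does not vary along the
second factor. On pairs `(Z, Z')` of the second factor its symmetric part is `ξ(ln f₁) = β` and its
skew part is `α g(φZ, Z') = 0` (`local_identities`). The component of `ξ` in `N₁` is dual to `η`, so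
it is independent of the point of `N₂`, and so is `β = ξ(ln f₁)`.

These arguments use only a condition symmetric in the two factors (`IsPhiOrthogonal`), so the case
of `ξ` tangent to the second factor follows by exchanging them. There the skew part lives on the
`φ`-invariant factor, where `g(φu, φu) ≠ 0` for `u ≠ 0`, which forces `α = 0` along the submanifold.
That one of the two cases holds globally comes from `φ² = -I + η ⊗ ξ`, invariance of the first
factor, and connectedness.

To spread `α = 0` over the ambient manifold, skew-symmetrise the identity: with `Φ(X, Y) = g(φX, Y)`
it reads `dη = -2 α Φ`, so `dα ∧ Φ = -α dΦ`. In dimension at least 5 the map `l ↦ l ∧ Φ` is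
injective on covectors, so locally `‖dα‖ ≤ C |α|`. By Grönwall the zero set of `α` is open; it is
also closed and nonempty. -/

noncomputable section
namespace DoublyWarpedCR

/-! ### Pull-backs of forms and metrics between normed spaces. -/

section Calculus

variable {E E' : Type*} [NormedAddCommGroup E] [NormedSpace ℝ E]
  [NormedAddCommGroup E'] [NormedSpace ℝ E']

lemma hasFDerivAt_pullback_form {F : E' → E} {p : E'} (hF : ContDiffAt ℝ 2 F p)
    {η : E → E →L[ℝ] ℝ} (hη : DifferentiableAt ℝ η (F p)) (Y : E') :
    HasFDerivAt (fun q => η (F q) (fderiv ℝ F q Y))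
      ((η (F p)).comp ((fderiv ℝ (fderiv ℝ F) p).flip Y) +
        ((fderiv ℝ η (F p)).comp (fderiv ℝ F p)).flip (fderiv ℝ F p Y)) p := by
  have h1 : HasFDerivAt F (fderiv ℝ F p) p := (hF.differentiableAt (by norm_num)).hasFDerivAt
  have h2 : HasFDerivAt (fderiv ℝ F) (fderiv ℝ (fderiv ℝ F) p) p :=
    ((hF.fderiv_right (m := 1) (by norm_num)).differentiableAt (by norm_num)).hasFDerivAt
  have h3 := hη.hasFDerivAt.comp p h1
  have h4 := h2.clm_apply (hasFDerivAt_const Y p)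
  refine (h3.clm_apply h4).congr_fderiv ?_
  ext v
  simp

lemma hasFDerivAt_pullback_bilin {F : E' → E} {p : E'} (hF : ContDiffAt ℝ 2 F p)
    {G : E → E →L[ℝ] E →L[ℝ] ℝ} (hG : DifferentiableAt ℝ G (F p)) (X Y : E') :
    HasFDerivAt (fun q => G (F q) (fderiv ℝ F q X) (fderiv ℝ F q Y))
      ((G (F p) (fderiv ℝ F p X)).comp ((fderiv ℝ (fderiv ℝ F) p).flip Y) +
        ((G (F p)).flip (fderiv ℝ F p Y)).comp ((fderiv ℝ (fderiv ℝ F) p).flip X) +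
        ((((fderiv ℝ G (F p)).comp (fderiv ℝ F p)).flip (fderiv ℝ F p X)).flip
          (fderiv ℝ F p Y))) p := by
  have h1 : HasFDerivAt F (fderiv ℝ F p) p := (hF.differentiableAt (by norm_num)).hasFDerivAt
  have h2 : HasFDerivAt (fderiv ℝ F) (fderiv ℝ (fderiv ℝ F) p) p :=
    ((hF.fderiv_right (m := 1) (by norm_num)).differentiableAt (by norm_num)).hasFDerivAt
  have h3 : HasFDerivAt (fun q => G (F q)) ((fderiv ℝ G (F p)).comp (fderiv ℝ F p)) p :=
    HasFDerivAt.comp (g := G) p hG.hasFDerivAt h1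
  have h4 := h2.clm_apply (hasFDerivAt_const X p)
  have h5 := h2.clm_apply (hasFDerivAt_const Y p)
  refine ((h3.clm_apply h4).clm_apply h5).congr_fderiv ?_
  ext v
  simp
  ring

/-- The expression `∇η` written with the Koszul formula is compatible with pull-backs. -/
lemma koszul_pullback {F : E' → E} {p : E'} (hF : ContDiffAt ℝ 2 F p)
    {η : E → E →L[ℝ] ℝ} (hη : DifferentiableAt ℝ η (F p))
    {G : E → E →L[ℝ] E →L[ℝ] ℝ} (hG : DifferentiableAt ℝ G (F p))
    (hsymm : ∀ v w, G (F p) v w = G (F p) w v)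
    {u : E} (hu : ∀ v, G (F p) v u = η (F p) v) {w : E'} (hw : fderiv ℝ F p w = u) (X Y : E') :
    2 * fderiv ℝ (fun q => η (F q) (fderiv ℝ F q Y)) p X -
      (fderiv ℝ (fun q => G (F q) (fderiv ℝ F q Y) (fderiv ℝ F q w)) p X +
       fderiv ℝ (fun q => G (F q) (fderiv ℝ F q X) (fderiv ℝ F q w)) p Y -
       fderiv ℝ (fun q => G (F q) (fderiv ℝ F q X) (fderiv ℝ F q Y)) p w) =
    2 * fderiv ℝ η (F p) (fderiv ℝ F p X) (fderiv ℝ F p Y) -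
      (fderiv ℝ G (F p) (fderiv ℝ F p X) (fderiv ℝ F p Y) u +
       fderiv ℝ G (F p) (fderiv ℝ F p Y) (fderiv ℝ F p X) u -
       fderiv ℝ G (F p) u (fderiv ℝ F p X) (fderiv ℝ F p Y)) := by
  have hs : IsSymmSndFDerivAt ℝ F p := hF.isSymmSndFDerivAt (by simp)
  rw [(hasFDerivAt_pullback_form hF hη Y).fderiv, (hasFDerivAt_pullback_bilin hF hG Y w).fderiv,
    (hasFDerivAt_pullback_bilin hF hG X w).fderiv, (hasFDerivAt_pullback_bilin hF hG X Y).fderiv]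
  simp only [add_apply, ContinuousLinearMap.comp_apply,
    ContinuousLinearMap.flip_apply, hw, hu]
  -- The second derivatives of `F` cancel: those in `(X, Y)` because `G(·, u) = η`, those in `(X,
  -- w)` and `(Y, w)` pairwise by the symmetry of `G` and of the second derivative.
  rw [hs.eq Y X, hs.eq w X, hs.eq w Y, hsymm (fderiv ℝ (fderiv ℝ F) p X w)]
  ring

end Calculus

/-! ### Coordinate vector fields of a chart. -/

section ChartField

variable {E : Type*} [NormedAddCommGroup E] [NormedSpace ℝ E]
  {M : Type*} [TopologicalSpace M] [ChartedSpace E M] [IsManifold 𝓘(ℝ, E) ∞ M]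

/-- The constant vector field on a normed space. -/
def constField (v : E) : ∀ x : E, TangentSpace 𝓘(ℝ, E) x :=
  fun x => (NormedSpace.fromTangentSpace x).symm v

lemma contMDiff_constField (v : E) :
    ContMDiff 𝓘(ℝ, E) (𝓘(ℝ, E).prod 𝓘(ℝ, E)) ∞
      (fun x => Bundle.TotalSpace.mk' E (E := fun q : E => TangentSpace 𝓘(ℝ, E) q) x
        (constField v x)) := fun _ =>
  contMDiffAt_vectorSpace_iff_contDiffAt.mpr contDiffAt_const

lemma mlieBracket_constField (v w x : E) :
    VectorField.mlieBracket 𝓘(ℝ, E) (constField v) (constField w) x = 0 := by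
  have h : VectorField.lieBracketWithin ℝ (fun _ : E => v) (fun _ : E => w) Set.univ x = 0 := by
    simp [VectorField.lieBracketWithin]
  rw [← VectorField.mlieBracketWithin_univ, VectorField.mlieBracketWithin_eq_lieBracketWithin]
  exact h

/-- The inverse of the derivative of the chart at `x₀`, at the point `q`. -/
def chartFrame (x₀ q : M) : E →L[ℝ] TangentSpace 𝓘(ℝ, E) q :=
  (mfderiv 𝓘(ℝ, E) 𝓘(ℝ, E) (extChartAt 𝓘(ℝ, E) x₀) q).inverse ∘L
    (NormedSpace.fromTangentSpace (extChartAt 𝓘(ℝ, E) x₀ q)).symm.toContinuousLinearMap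

/-- The vector field with constant coefficient vector `v` in the chart at `x₀`. -/
abbrev chartField (x₀ : M) (v : E) : ∀ q : M, TangentSpace 𝓘(ℝ, E) q :=
  fun q => chartFrame x₀ q v

omit [IsManifold 𝓘(ℝ, E) ∞ M] in
lemma chartField_eq_mpullback (x₀ : M) (v : E) : chartField x₀ v =
    VectorField.mpullback 𝓘(ℝ, E) 𝓘(ℝ, E) (extChartAt 𝓘(ℝ, E) x₀) (constField v) := rfl

lemma contMDiffAt_chartField [CompleteSpace E] (x₀ : M) (v : E) {q : M}
    (hq : q ∈ (chartAt E x₀).source) :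
    ContMDiffAt 𝓘(ℝ, E) (𝓘(ℝ, E).prod 𝓘(ℝ, E)) ∞
      (fun q => Bundle.TotalSpace.mk' E (E := fun q : M => TangentSpace 𝓘(ℝ, E) q) q
        (chartField x₀ v q)) q := by
  have : IsManifold 𝓘(ℝ, E) 1 M := IsManifold.of_le (n := ∞) (by simp)
  have h := ContMDiffAt.mpullback_vectorField_preimage (I := 𝓘(ℝ, E)) (I' := 𝓘(ℝ, E))
    (f := extChartAt 𝓘(ℝ, E) x₀) (V := constField v) (n := ∞) (m := ∞) (x₀ := q)
    (contMDiff_constField v _) (contMDiffAt_extChartAt' hq)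
    (isInvertible_mfderiv_extChartAt (by simpa using hq)) (by simp)
  exact h

/-- Brackets commute with pull-back by the chart, and constant fields commute. This is what removes
the bracket terms from the Koszul formula. -/
lemma mlieBracket_chartField [CompleteSpace E] (x₀ : M) (v w : E) {q : M}
    (hq : q ∈ (chartAt E x₀).source) :
    VectorField.mlieBracket 𝓘(ℝ, E) (chartField x₀ v) (chartField x₀ w) q = 0 := by
  have h2 : minSmoothness ℝ 2 ≤ ∞ := by
    rw [minSmoothness_of_isRCLikeNormedField]; exact ENat.LEInfty.out
  have : IsManifold 𝓘(ℝ, E) (minSmoothness ℝ 2) M := IsManifold.of_le (n := ∞) h2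
  have h := VectorField.mpullback_mlieBracket (I := 𝓘(ℝ, E)) (I' := 𝓘(ℝ, E)) (n := ∞)
    (f := extChartAt 𝓘(ℝ, E) x₀) (x₀ := q)
    ((contMDiff_constField v _).mdifferentiableAt (by simp))
    ((contMDiff_constField w _).mdifferentiableAt (by simp)) (contMDiffAt_extChartAt' hq) h2
  rw [chartField_eq_mpullback, chartField_eq_mpullback, ← h, VectorField.mpullback_apply,
    mlieBracket_constField, map_zero]

lemma mfderiv_extChartAt_symm_apply (x₀ : M) {x : E} (hx : x ∈ (extChartAt 𝓘(ℝ, E) x₀).target)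
    (v : E) :
    mfderiv 𝓘(ℝ, E) 𝓘(ℝ, E) (extChartAt 𝓘(ℝ, E) x₀).symm x
        ((NormedSpace.fromTangentSpace x).symm v) =
      chartField x₀ v ((extChartAt 𝓘(ℝ, E) x₀).symm x) := by
  have : IsManifold 𝓘(ℝ, E) 1 M := IsManifold.of_le (n := ∞) (by simp)
  have h1 := mfderiv_extChartAt_comp_mfderivWithin_extChartAt_symm (I := 𝓘(ℝ, E)) hx
  have h2 := mfderivWithin_extChartAt_symm_comp_mfderiv_extChartAt (I := 𝓘(ℝ, E)) hx
  simp only [modelWithCornersSelf_coe, Set.range_id, mfderivWithin_univ] at h1 h2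
  have := ContinuousLinearMap.inverse_eq h1 h2
  exact (DFunLike.congr_fun this v).symm

end ChartField

/-! ### The covariant derivatives of `ξ` and `η` on a trans-Sasakian manifold. -/

section AmbientIdentities

variable {E : Type*} [NormedAddCommGroup E] [NormedSpace ℝ E]
  {H : Type*} [TopologicalSpace H] {I : ModelWithCorners ℝ E H}
  {M : Type*} [TopologicalSpace M] [ChartedSpace H M] [IsManifold I ∞ M]
  {g : RiemMetric I M}

namespace AlmostContactMetric

variable (S : AlmostContactMetric g)

lemma inner_xi (p : M) (u : TangentSpace I p) : g.inner p u (S.xi p) = S.eta p u := by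
  have h := S.inner_phi_phi p u (S.xi p)
  rw [S.phi_xi, map_zero, S.eta_xi] at h
  linarith

lemma xi_inner (p : M) (u : TangentSpace I p) : g.inner p (S.xi p) u = S.eta p u := by
  rw [g.symm, S.inner_xi]

lemma inner_phi_left (p : M) (u v : TangentSpace I p) :
    g.inner p (S.phi p u) v = -g.inner p u (S.phi p v) := by
  have h := S.inner_phi_phi p u (S.phi p v)
  rw [S.phi_phi, S.eta_phi, map_add, map_smul, map_neg, S.inner_xi, S.eta_phi] at h
  simp only [smul_eq_mul, mul_zero, add_zero, sub_zero] at h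
  linarith

lemma mdifferentiableAt_xi (p : M) : MDifferentiableAt I (I.prod 𝓘(ℝ, E))
    (fun q => Bundle.TotalSpace.mk' E (E := fun q : M => TangentSpace I q) q (S.xi q)) p :=
  (S.smooth_xi p).mdifferentiableAt (by simp)

end AlmostContactMetric

variable [FiniteDimensional ℝ E] {S : AlmostContactMetric g}
  {cov : CovariantDerivative I E (TangentSpace I : M → Type _)}

/-- `ξ` has constant length one, so its derivatives are orthogonal to it. -/
lemma eta_cov_xi (hcov : IsLeviCivita g cov) (p : M) (v : TangentSpace I p) :
    S.eta p (cov S.xi p v) = 0 := by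
  have h := hcov.metric S.xi S.xi p (S.mdifferentiableAt_xi p) (S.mdifferentiableAt_xi p) v
  simp only [S.inner_xi, S.xi_inner, S.eta_xi] at h
  rw [mvfderiv_const] at h
  simp only [zero_apply] at h
  linarith

lemma cov_xi (hcov : IsLeviCivita g cov) {α β : M → ℝ} (hS : IsTransSasakian S cov α β)
    (p : M) (v : TangentSpace I p) :
    cov S.xi p v = -(α p • S.phi p v) + β p • (v - S.eta p v • S.xi p) := by
  have h := hS.nabla_phi S.xi S.smooth_xi p v
  have h0 : (fun q => S.phi q (S.xi q)) = 0 := funext fun q => S.phi_xi q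
  rw [h0, cov.zero] at h
  simp only [Pi.zero_apply, zero_apply, S.inner_xi, S.eta_xi, S.eta_phi, one_smul, zero_smul,
    zero_sub] at h
  -- At this point `φ(∇_v ξ)` is known. Since `φ² = -I + η ⊗ ξ` and `∇_v ξ` has no component along
  -- `ξ`, a second application of `φ` recovers `∇_v ξ`.
  have h1 := congrArg (S.phi p) h
  simp only [map_neg, map_add, map_sub, map_smul, S.phi_phi, S.phi_xi, eta_cov_xi hcov] at h1
  simp only [smul_zero, zero_smul, add_zero, neg_neg, zero_sub] at h1
  rw [h1]
  module

/-- The covariant derivative of `η`, expressed with the Koszul formula for commuting fields. -/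
lemma koszul_eta (hcov : IsLeviCivita g cov) {α β : M → ℝ} (hS : IsTransSasakian S cov α β)
    {X Y U : ∀ p : M, TangentSpace I p} {p : M}
    (hX : MDifferentiableAt I (I.prod 𝓘(ℝ, E))
      (fun q => Bundle.TotalSpace.mk' E (E := fun q : M => TangentSpace I q) q (X q)) p)
    (hY : MDifferentiableAt I (I.prod 𝓘(ℝ, E))
      (fun q => Bundle.TotalSpace.mk' E (E := fun q : M => TangentSpace I q) q (Y q)) p)
    (hU : MDifferentiableAt I (I.prod 𝓘(ℝ, E))
      (fun q => Bundle.TotalSpace.mk' E (E := fun q : M => TangentSpace I q) q (U q)) p)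
    (hXY : VectorField.mlieBracket I X Y p = 0) (hXU : VectorField.mlieBracket I X U p = 0)
    (hYU : VectorField.mlieBracket I Y U p = 0) (hUxi : U p = S.xi p) :
    2 * mvfderiv I (fun q => S.eta q (Y q)) p (X p) -
      (mvfderiv I (fun q => g.inner q (Y q) (U q)) p (X p) +
       mvfderiv I (fun q => g.inner q (X q) (U q)) p (Y p) -
       mvfderiv I (fun q => g.inner q (X q) (Y q)) p (U p)) =
    2 * (-(α p * g.inner p (S.phi p (X p)) (Y p)) +
      β p * (g.inner p (X p) (Y p) - S.eta p (X p) * S.eta p (Y p))) := by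
  have t1 := cov.torsion_eq_zero_iff.1 hcov.torsion_free hX hY
  have t2 := cov.torsion_eq_zero_iff.1 hcov.torsion_free hX hU
  have t3 := cov.torsion_eq_zero_iff.1 hcov.torsion_free hY hU
  rw [hXY, sub_eq_zero] at t1
  rw [hXU, sub_eq_zero] at t2
  rw [hYU, sub_eq_zero] at t3
  have e : (fun q => S.eta q (Y q)) = fun q => g.inner q (Y q) (S.xi q) :=
    funext fun q => (S.inner_xi q _).symm
  -- `η(Y)` is differentiated as `g(Y, ξ)` with the true field `ξ`, the other terms with `U`, which
  -- equals `ξ` only at `p`. By the torsion identities everything cancels except `2 g(Y, ∇_X ξ)`.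
  rw [e, hcov.metric Y S.xi p hY (S.mdifferentiableAt_xi p), hcov.metric Y U p hY hU,
    hcov.metric X U p hX hU, hcov.metric X Y p hX hY, cov_xi hcov hS, t1, t2, t3, hUxi,
    g.symm p (Y p)]
  simp only [map_add, map_sub, map_neg, map_smul, add_apply, sub_apply, neg_apply, smul_apply,
    smul_eq_mul, S.xi_inner, S.inner_xi]
  rw [g.symm p (Y p) (cov X p (S.xi p))]
  ring

end AmbientIdentities

/-! ### Derivatives of maps from a normed space to a manifold. -/

section Dmap

variable {E : Type*} [NormedAddCommGroup E] [NormedSpace ℝ E]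
  {H : Type*} [TopologicalSpace H] (I : ModelWithCorners ℝ E H)
  {M : Type*} [TopologicalSpace M] [ChartedSpace H M]
  {E' : Type*} [NormedAddCommGroup E'] [NormedSpace ℝ E']

/-- The derivative at `q` of a map from a normed space to a manifold. -/
def dmap (κ : E' → M) (q : E') : E' →L[ℝ] TangentSpace I (κ q) :=
  (mfderiv 𝓘(ℝ, E') I κ q) ∘L (NormedSpace.fromTangentSpace q).symm.toContinuousLinearMap

variable {I}

lemma dmap_comp {H₂ : Type*} [TopologicalSpace H₂] {E₂ : Type*} [NormedAddCommGroup E₂]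
    [NormedSpace ℝ E₂] {J : ModelWithCorners ℝ E₂ H₂}
    {N : Type*} [TopologicalSpace N] [ChartedSpace H₂ N] {f : N → M} {ψ : E' → N} {q : E'}
    (hf : MDifferentiableAt J I f (ψ q)) (hψ : MDifferentiableAt 𝓘(ℝ, E') J ψ q) (Y : E') :
    dmap I (f ∘ ψ) q Y = mfderiv J I f (ψ q) (dmap J ψ q Y) :=
  DFunLike.congr_fun (mfderiv_comp q hf hψ) ((NormedSpace.fromTangentSpace q).symm Y)

lemma dmap_comp_fderiv {E₂ : Type*} [NormedAddCommGroup E₂] [NormedSpace ℝ E₂]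
    {ψ : E' → M} {L : E₂ → E'} {q : E₂}
    (hψ : MDifferentiableAt 𝓘(ℝ, E') I ψ (L q)) (hL : DifferentiableAt ℝ L q) (Y : E₂) :
    dmap I (ψ ∘ L) q Y = dmap I ψ (L q) (fderiv ℝ L q Y) := by
  refine (dmap_comp hψ hL.mdifferentiableAt Y).trans ?_
  have : mfderiv 𝓘(ℝ, E₂) 𝓘(ℝ, E') L q = fderiv ℝ L q := mfderiv_eq_fderiv
  exact congrArg (mfderiv 𝓘(ℝ, E') I ψ (L q)) (DFunLike.congr_fun this Y)

lemma fderiv_comp_eq_mvfderiv {f : M → ℝ} {ψ : E' → M} {q : E'}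
    (hf : MDifferentiableAt I 𝓘(ℝ, ℝ) f (ψ q)) (hψ : MDifferentiableAt 𝓘(ℝ, E') I ψ q) (Y : E') :
    fderiv ℝ (f ∘ ψ) q Y = mvfderiv I f (ψ q) (dmap I ψ q Y) := by
  rw [← mfderiv_eq_fderiv]
  exact DFunLike.congr_fun (mfderiv_comp q hf hψ) Y

end Dmap

/-! ### The metric, `η` and `φ` read in a chart. -/

section ChartReading

variable {E : Type*} [NormedAddCommGroup E] [NormedSpace ℝ E]
  {M : Type*} [TopologicalSpace M] [ChartedSpace E M] [IsManifold 𝓘(ℝ, E) ∞ M]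

lemma dmap_extChartAt_symm (x₀ : M) {x : E} (hx : x ∈ (extChartAt 𝓘(ℝ, E) x₀).target) (v : E) :
    dmap 𝓘(ℝ, E) (extChartAt 𝓘(ℝ, E) x₀).symm x v =
      chartFrame x₀ ((extChartAt 𝓘(ℝ, E) x₀).symm x) v :=
  mfderiv_extChartAt_symm_apply x₀ hx v

lemma dmap_eq_chartFrame {E' : Type*} [NormedAddCommGroup E'] [NormedSpace ℝ E']
    {κ : E' → M} {x₀ : M} {q : E'} (hκ : MDifferentiableAt 𝓘(ℝ, E') 𝓘(ℝ, E) κ q)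
    (hq : κ q ∈ (chartAt E x₀).source) (Y : E') :
    dmap 𝓘(ℝ, E) κ q Y =
      chartFrame x₀ (κ q) (fderiv ℝ (extChartAt 𝓘(ℝ, E) x₀ ∘ κ) q Y) := by
  have : IsManifold 𝓘(ℝ, E) 1 M := IsManifold.of_le (n := ∞) (by simp)
  have hs : κ q ∈ (extChartAt 𝓘(ℝ, E) x₀).source := by simpa using hq
  have h1 : fderiv ℝ (extChartAt 𝓘(ℝ, E) x₀ ∘ κ) q Y =
      mfderiv 𝓘(ℝ, E) 𝓘(ℝ, E) (extChartAt 𝓘(ℝ, E) x₀) (κ q) (dmap 𝓘(ℝ, E) κ q Y) := by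
    rw [← mfderiv_eq_fderiv]
    exact DFunLike.congr_fun (mfderiv_comp q (mdifferentiableAt_extChartAt hq) hκ) Y
  rw [h1]
  have h2 := (isInvertible_mfderiv_extChartAt (I := 𝓘(ℝ, E)) hs).inverse_comp_self
  exact (DFunLike.congr_fun h2 (dmap 𝓘(ℝ, E) κ q Y)).symm

lemma exists_chartFrame_eq (x₀ : M) {q : M} (hq : q ∈ (chartAt E x₀).source)
    (w : TangentSpace 𝓘(ℝ, E) q) : ∃ v : E, chartFrame x₀ q v = w := by
  have : IsManifold 𝓘(ℝ, E) 1 M := IsManifold.of_le (n := ∞) (by simp)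
  have hs : q ∈ (extChartAt 𝓘(ℝ, E) x₀).source := by simpa using hq
  have h2 := (isInvertible_mfderiv_extChartAt (I := 𝓘(ℝ, E)) hs).inverse_comp_self
  exact ⟨mfderiv 𝓘(ℝ, E) 𝓘(ℝ, E) (extChartAt 𝓘(ℝ, E) x₀) q w, DFunLike.congr_fun h2 w⟩

variable [FiniteDimensional ℝ E] {g : RiemMetric 𝓘(ℝ, E) M}

lemma contMDiffAt_metric_chartField (g : RiemMetric 𝓘(ℝ, E) M) (x₀ : M) (v w : E) {q : M}
    (hq : q ∈ (chartAt E x₀).source) :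
    ContMDiffAt 𝓘(ℝ, E) 𝓘(ℝ, ℝ) ∞
      (fun q => g.inner q (chartFrame x₀ q v) (chartFrame x₀ q w)) q := by
  have := FiniteDimensional.complete ℝ E
  have : ContMDiffAt 𝓘(ℝ, E) (𝓘(ℝ, E).prod 𝓘(ℝ)) ∞
      (fun m ↦ Bundle.TotalSpace.mk' ℝ (E := Bundle.Trivial M ℝ) m
        (g.inner m (chartFrame x₀ m v) (chartFrame x₀ m w))) q := by
    apply ContMDiffAt.clm_bundle_apply₂ (F₁ := E) (F₂ := E)
    · exact g.contMDiff q
    · exact contMDiffAt_chartField x₀ v hq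
    · exact contMDiffAt_chartField x₀ w hq
  exact (Bundle.contMDiffAt_totalSpace.1 this).2

lemma contMDiffAt_eta_chartField (S : AlmostContactMetric g) (x₀ : M) (v : E) {q : M}
    (hq : q ∈ (chartAt E x₀).source) :
    ContMDiffAt 𝓘(ℝ, E) 𝓘(ℝ, ℝ) ∞ (fun q => S.eta q (chartFrame x₀ q v)) q := by
  have := FiniteDimensional.complete ℝ E
  have : ContMDiffAt 𝓘(ℝ, E) (𝓘(ℝ, E).prod 𝓘(ℝ)) ∞
      (fun m ↦ Bundle.TotalSpace.mk' ℝ (E := Bundle.Trivial M ℝ) m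
        (S.eta m (chartFrame x₀ m v))) q := by
    apply ContMDiffAt.clm_bundle_apply (F₁ := E)
    · exact S.smooth_eta q
    · exact contMDiffAt_chartField x₀ v hq
  exact (Bundle.contMDiffAt_totalSpace.1 this).2

lemma contMDiffAt_metric_phi_chartField (S : AlmostContactMetric g) (x₀ : M) (v w : E) {q : M}
    (hq : q ∈ (chartAt E x₀).source) :
    ContMDiffAt 𝓘(ℝ, E) 𝓘(ℝ, ℝ) ∞
      (fun q => g.inner q (S.phi q (chartFrame x₀ q v)) (chartFrame x₀ q w)) q := by
  have := FiniteDimensional.complete ℝ E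
  have : ContMDiffAt 𝓘(ℝ, E) (𝓘(ℝ, E).prod 𝓘(ℝ)) ∞
      (fun m ↦ Bundle.TotalSpace.mk' ℝ (E := Bundle.Trivial M ℝ) m
        (g.inner m (S.phi m (chartFrame x₀ m v)) (chartFrame x₀ m w))) q := by
    apply ContMDiffAt.clm_bundle_apply₂ (F₁ := E) (F₂ := E)
    · exact g.contMDiff q
    · apply ContMDiffAt.clm_bundle_apply (F₁ := E)
      · exact S.smooth_phi q
      · exact contMDiffAt_chartField x₀ v hq
    · exact contMDiffAt_chartField x₀ w hq
  exact (Bundle.contMDiffAt_totalSpace.1 this).2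

omit [FiniteDimensional ℝ E] in
lemma contDiffOn_comp_extChartAt_symm {f : M → ℝ} {x₀ : M}
    (hf : ∀ q ∈ (chartAt E x₀).source, ContMDiffAt 𝓘(ℝ, E) 𝓘(ℝ, ℝ) ∞ f q) :
    ContDiffOn ℝ ∞ (f ∘ (extChartAt 𝓘(ℝ, E) x₀).symm) (extChartAt 𝓘(ℝ, E) x₀).target := by
  rw [← contMDiffOn_iff_contDiffOn]
  refine ContMDiffOn.comp (t := (chartAt E x₀).source) (fun q hq => (hf q hq).contMDiffWithinAt)
    (contMDiffOn_extChartAt_symm x₀) fun x hx => ?_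
  simpa using (extChartAt 𝓘(ℝ, E) x₀).map_target hx

/-- The `1`-form `η` in the chart at `x₀`. -/
def etaChart (S : AlmostContactMetric g) (x₀ : M) (x : E) : E →L[ℝ] ℝ :=
  (S.eta ((extChartAt 𝓘(ℝ, E) x₀).symm x)) ∘L chartFrame x₀ ((extChartAt 𝓘(ℝ, E) x₀).symm x)

/-- A field of bilinear forms in the chart at `x₀`. -/
def bilinChart (B : ∀ q : M, TangentSpace 𝓘(ℝ, E) q →L[ℝ] TangentSpace 𝓘(ℝ, E) q →L[ℝ] ℝ)
    (x₀ : M) (x : E) : E →L[ℝ] E →L[ℝ] ℝ :=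
  LinearMap.toContinuousBilinearMap <|
    LinearMap.mk₂ ℝ (fun v w => B ((extChartAt 𝓘(ℝ, E) x₀).symm x)
      (chartFrame x₀ ((extChartAt 𝓘(ℝ, E) x₀).symm x) v)
      (chartFrame x₀ ((extChartAt 𝓘(ℝ, E) x₀).symm x) w))
    (by intros; simp only [map_add, add_apply])
    (by intros; simp only [map_smul, smul_apply])
    (by intros; simp only [map_add]) (by intros; simp only [map_smul])

lemma contDiffOn_etaChart (S : AlmostContactMetric g) (x₀ : M) :
    ContDiffOn ℝ ∞ (etaChart S x₀) (extChartAt 𝓘(ℝ, E) x₀).target :=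
  contDiffOn_clm_apply.2 fun v => contDiffOn_comp_extChartAt_symm
    (f := fun q => S.eta q (chartFrame x₀ q v)) fun _ hq => contMDiffAt_eta_chartField S x₀ v hq

lemma contDiffOn_bilinChart
    {B : ∀ q : M, TangentSpace 𝓘(ℝ, E) q →L[ℝ] TangentSpace 𝓘(ℝ, E) q →L[ℝ] ℝ} (x₀ : M)
    (hB : ∀ v w, ∀ q ∈ (chartAt E x₀).source, ContMDiffAt 𝓘(ℝ, E) 𝓘(ℝ, ℝ) ∞
      (fun q => B q (chartFrame x₀ q v) (chartFrame x₀ q w)) q) :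
    ContDiffOn ℝ ∞ (bilinChart B x₀) (extChartAt 𝓘(ℝ, E) x₀).target :=
  contDiffOn_clm_apply.2 fun v => contDiffOn_clm_apply.2 fun w => contDiffOn_comp_extChartAt_symm
    (f := fun q => B q (chartFrame x₀ q v) (chartFrame x₀ q w)) fun q hq => hB v w q hq

end ChartReading

/-! ### Pulling the formula for `∇η` back to a parameter space. -/

section PullBack
open Filter Topology

lemma fderiv_clm_apply_const {E F G : Type*} [NormedAddCommGroup E] [NormedSpace ℝ E]
    [NormedAddCommGroup F] [NormedSpace ℝ F] [NormedAddCommGroup G] [NormedSpace ℝ G]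
    {A : E → F →L[ℝ] G} {x : E} (hA : DifferentiableAt ℝ A x) (w : F) (v : E) :
    fderiv ℝ (fun x => A x w) x v = fderiv ℝ A x v w := by
  rw [(hA.hasFDerivAt.clm_apply (hasFDerivAt_const w x)).fderiv]
  simp

lemma fderiv_clm_apply_const₂ {E F F' G : Type*} [NormedAddCommGroup E] [NormedSpace ℝ E]
    [NormedAddCommGroup F] [NormedSpace ℝ F] [NormedAddCommGroup F'] [NormedSpace ℝ F']
    [NormedAddCommGroup G] [NormedSpace ℝ G]
    {A : E → F →L[ℝ] F' →L[ℝ] G} {x : E} (hA : DifferentiableAt ℝ A x) (w : F) (u : F') (v : E) :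
    fderiv ℝ (fun x => A x w u) x v = fderiv ℝ A x v w u := by
  rw [fderiv_clm_apply_const (hA.clm_apply (differentiableAt_const w)),
    fderiv_clm_apply_const hA]

variable {E : Type*} [NormedAddCommGroup E] [NormedSpace ℝ E] [FiniteDimensional ℝ E]
  {M : Type*} [TopologicalSpace M] [ChartedSpace E M] [IsManifold 𝓘(ℝ, E) ∞ M]
  {g : RiemMetric 𝓘(ℝ, E) M}
  {E' : Type*} [NormedAddCommGroup E'] [NormedSpace ℝ E']

omit [FiniteDimensional ℝ E] in
lemma etaChart_apply (S : AlmostContactMetric g) {x₀ q : M} {x : E}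
    (h : (extChartAt 𝓘(ℝ, E) x₀).symm x = q) (v : E) :
    etaChart S x₀ x v = S.eta q (chartFrame x₀ q v) := by
  subst h; rfl

omit [IsManifold 𝓘(ℝ, E) ∞ M] in
lemma bilinChart_apply
    (B : ∀ q : M, TangentSpace 𝓘(ℝ, E) q →L[ℝ] TangentSpace 𝓘(ℝ, E) q →L[ℝ] ℝ)
    {x₀ q : M} {x : E} (h : (extChartAt 𝓘(ℝ, E) x₀).symm x = q) (v w : E) :
    bilinChart B x₀ x v w = B q (chartFrame x₀ q v) (chartFrame x₀ q w) := by
  subst h; rfl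

variable {κ : E' → M} {W : Set E'}

omit [FiniteDimensional ℝ E] [IsManifold 𝓘(ℝ, E) ∞ M] in
lemma eventually_chart (hW : IsOpen W) (hκ : ContMDiffOn 𝓘(ℝ, E') 𝓘(ℝ, E) ∞ κ W) {p : E'}
    (hp : p ∈ W) : ∀ᶠ q in 𝓝 p,
      MDifferentiableAt 𝓘(ℝ, E') 𝓘(ℝ, E) κ q ∧ κ q ∈ (chartAt E (κ p)).source := by
  have h1 := ((hκ p hp).contMDiffAt (hW.mem_nhds hp)).continuousAt
  filter_upwards [hW.mem_nhds hp, h1.preimage_mem_nhds (chart_source_mem_nhds E (κ p))]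
    with q hq hq'
  exact ⟨((hκ q hq).contMDiffAt (hW.mem_nhds hq)).mdifferentiableAt (by simp), hq'⟩

omit [FiniteDimensional ℝ E] in
lemma eta_pullback_eventuallyEq (S : AlmostContactMetric g) (hW : IsOpen W)
    (hκ : ContMDiffOn 𝓘(ℝ, E') 𝓘(ℝ, E) ∞ κ W) {p : E'} (hp : p ∈ W) (Y : E') :
    (fun q => S.eta (κ q) (dmap 𝓘(ℝ, E) κ q Y)) =ᶠ[𝓝 p]
      fun q => etaChart S (κ p) ((extChartAt 𝓘(ℝ, E) (κ p) ∘ κ) q)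
        (fderiv ℝ (extChartAt 𝓘(ℝ, E) (κ p) ∘ κ) q Y) := by
  filter_upwards [eventually_chart hW hκ hp] with q hq
  have hl : (extChartAt 𝓘(ℝ, E) (κ p)).symm ((extChartAt 𝓘(ℝ, E) (κ p) ∘ κ) q) = κ q :=
    (extChartAt 𝓘(ℝ, E) (κ p)).left_inv (by simpa using hq.2)
  rw [etaChart_apply S hl,
    dmap_eq_chartFrame hq.1 hq.2]

lemma bilin_pullback_eventuallyEq
    (B : ∀ q : M, TangentSpace 𝓘(ℝ, E) q →L[ℝ] TangentSpace 𝓘(ℝ, E) q →L[ℝ] ℝ) (hW : IsOpen W)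
    (hκ : ContMDiffOn 𝓘(ℝ, E') 𝓘(ℝ, E) ∞ κ W) {p : E'} (hp : p ∈ W) (X Y : E') :
    (fun q => B (κ q) (dmap 𝓘(ℝ, E) κ q X) (dmap 𝓘(ℝ, E) κ q Y)) =ᶠ[𝓝 p]
      fun q => bilinChart B (κ p) ((extChartAt 𝓘(ℝ, E) (κ p) ∘ κ) q)
        (fderiv ℝ (extChartAt 𝓘(ℝ, E) (κ p) ∘ κ) q X)
        (fderiv ℝ (extChartAt 𝓘(ℝ, E) (κ p) ∘ κ) q Y) := by
  filter_upwards [eventually_chart hW hκ hp] with q hq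
  have hl : (extChartAt 𝓘(ℝ, E) (κ p)).symm ((extChartAt 𝓘(ℝ, E) (κ p) ∘ κ) q) = κ q :=
    (extChartAt 𝓘(ℝ, E) (κ p)).left_inv (by simpa using hq.2)
  rw [bilinChart_apply B hl,
    dmap_eq_chartFrame hq.1 hq.2, dmap_eq_chartFrame hq.1 hq.2]

omit [FiniteDimensional ℝ E] [IsManifold 𝓘(ℝ, E) ∞ M] in
lemma contDiffAt_extChartAt_comp (hW : IsOpen W)
    (hκ : ContMDiffOn 𝓘(ℝ, E') 𝓘(ℝ, E) ∞ κ W) {p : E'} (hp : p ∈ W) :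
    ContDiffAt ℝ ∞ (extChartAt 𝓘(ℝ, E) (κ p) ∘ κ) p := by
  rw [← contMDiffAt_iff_contDiffAt]
  exact (contMDiffAt_extChartAt (x := κ p)).comp p ((hκ p hp).contMDiffAt (hW.mem_nhds hp))

omit [FiniteDimensional ℝ E] [IsManifold 𝓘(ℝ, E) ∞ M] in
lemma contDiffAt_fderiv_extChartAt_comp (hW : IsOpen W)
    (hκ : ContMDiffOn 𝓘(ℝ, E') 𝓘(ℝ, E) ∞ κ W) {p : E'} (hp : p ∈ W) (Y : E') :
    ContDiffAt ℝ ∞ (fun q => fderiv ℝ (extChartAt 𝓘(ℝ, E) (κ p) ∘ κ) q Y) p :=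
  ((contDiffAt_extChartAt_comp hW hκ hp).fderiv_right (m := ∞) (by simp)).clm_apply contDiffAt_const

lemma contDiffOn_eta_pullback (S : AlmostContactMetric g) (hW : IsOpen W)
    (hκ : ContMDiffOn 𝓘(ℝ, E') 𝓘(ℝ, E) ∞ κ W) (Y : E') :
    ContDiffOn ℝ ∞ (fun q => S.eta (κ q) (dmap 𝓘(ℝ, E) κ q Y)) W := by
  intro p hp
  refine ContDiffAt.contDiffWithinAt ?_
  refine ContDiffAt.congr_of_eventuallyEq ?_ (eta_pullback_eventuallyEq S hW hκ hp Y)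
  have h : ContDiffAt ℝ ∞ (etaChart S (κ p)) (extChartAt 𝓘(ℝ, E) (κ p) (κ p)) :=
    (contDiffOn_etaChart S (κ p)).contDiffAt (extChartAt_target_mem_nhds (κ p))
  exact (h.comp p (contDiffAt_extChartAt_comp hW hκ hp)).clm_apply
    (contDiffAt_fderiv_extChartAt_comp hW hκ hp Y)

lemma contDiffOn_bilin_pullback
    {B : ∀ q : M, TangentSpace 𝓘(ℝ, E) q →L[ℝ] TangentSpace 𝓘(ℝ, E) q →L[ℝ] ℝ}
    (hB : ∀ (x₀ : M) (v w : E), ∀ q ∈ (chartAt E x₀).source, ContMDiffAt 𝓘(ℝ, E) 𝓘(ℝ, ℝ) ∞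
      (fun q => B q (chartFrame x₀ q v) (chartFrame x₀ q w)) q) (hW : IsOpen W)
    (hκ : ContMDiffOn 𝓘(ℝ, E') 𝓘(ℝ, E) ∞ κ W) (X Y : E') :
    ContDiffOn ℝ ∞ (fun q => B (κ q) (dmap 𝓘(ℝ, E) κ q X) (dmap 𝓘(ℝ, E) κ q Y)) W := by
  intro p hp
  refine ContDiffAt.contDiffWithinAt ?_
  refine ContDiffAt.congr_of_eventuallyEq ?_ (bilin_pullback_eventuallyEq B hW hκ hp X Y)
  have h : ContDiffAt ℝ ∞ (bilinChart B (κ p)) (extChartAt 𝓘(ℝ, E) (κ p) (κ p)) :=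
    (contDiffOn_bilinChart (κ p) (hB (κ p))).contDiffAt (extChartAt_target_mem_nhds (κ p))
  exact ((h.comp p (contDiffAt_extChartAt_comp hW hκ hp)).clm_apply
    (contDiffAt_fderiv_extChartAt_comp hW hκ hp X)).clm_apply
    (contDiffAt_fderiv_extChartAt_comp hW hκ hp Y)

lemma contDiffOn_metric_pullback (g : RiemMetric 𝓘(ℝ, E) M) (hW : IsOpen W)
    (hκ : ContMDiffOn 𝓘(ℝ, E') 𝓘(ℝ, E) ∞ κ W) (X Y : E') :
    ContDiffOn ℝ ∞ (fun q => g.inner (κ q) (dmap 𝓘(ℝ, E) κ q X) (dmap 𝓘(ℝ, E) κ q Y)) W :=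
  contDiffOn_bilin_pullback (B := g.inner)
    (fun x₀ v w _ hq => contMDiffAt_metric_chartField g x₀ v w hq) hW hκ X Y

lemma contDiffOn_metric_phi_pullback (S : AlmostContactMetric g) (hW : IsOpen W)
    (hκ : ContMDiffOn 𝓘(ℝ, E') 𝓘(ℝ, E) ∞ κ W) (X Y : E') :
    ContDiffOn ℝ ∞
      (fun q => g.inner (κ q) (S.phi (κ q) (dmap 𝓘(ℝ, E) κ q X)) (dmap 𝓘(ℝ, E) κ q Y)) W :=
  contDiffOn_bilin_pullback (B := fun q => g.inner q ∘L S.phi q)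
    (fun x₀ v w _ hq => contMDiffAt_metric_phi_chartField S x₀ v w hq) hW hκ X Y

variable {S : AlmostContactMetric g}
  {cov : CovariantDerivative 𝓘(ℝ, E) E (TangentSpace 𝓘(ℝ, E) : M → Type _)}

omit [FiniteDimensional ℝ E] in
-- The centre of the chart suffices: at each parameter `p` the ambient chart is taken around `κ p`.
lemma fderiv_comp_extChartAt_symm {f : M → ℝ} {x₀ : M}
    (hf : MDifferentiableAt 𝓘(ℝ, E) 𝓘(ℝ, ℝ) f x₀) (v : E) :
    fderiv ℝ (f ∘ (extChartAt 𝓘(ℝ, E) x₀).symm) (extChartAt 𝓘(ℝ, E) x₀ x₀) v =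
      mvfderiv 𝓘(ℝ, E) f x₀ (chartFrame x₀ x₀ v) := by
  have hl : (extChartAt 𝓘(ℝ, E) x₀).symm (extChartAt 𝓘(ℝ, E) x₀ x₀) = x₀ :=
    extChartAt_to_inv (I := 𝓘(ℝ, E)) x₀
  have hψ : MDifferentiableAt 𝓘(ℝ, E) 𝓘(ℝ, E) (extChartAt 𝓘(ℝ, E) x₀).symm
      (extChartAt 𝓘(ℝ, E) x₀ x₀) :=
    ((contMDiffOn_extChartAt_symm (n := ∞) x₀).contMDiffAt
      (extChartAt_target_mem_nhds x₀)).mdifferentiableAt (by simp)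
  have hf' : MDifferentiableAt 𝓘(ℝ, E) 𝓘(ℝ, ℝ) f
      ((extChartAt 𝓘(ℝ, E) x₀).symm (extChartAt 𝓘(ℝ, E) x₀ x₀)) := by rwa [hl]
  rw [fderiv_comp_eq_mvfderiv hf' hψ,
    dmap_extChartAt_symm x₀ (mem_extChartAt_target (I := 𝓘(ℝ, E)) x₀), hl]

lemma fderiv_etaChart_apply (S : AlmostContactMetric g) (x₀ : M) (v w : E) :
    fderiv ℝ (etaChart S x₀) (extChartAt 𝓘(ℝ, E) x₀ x₀) v w =
      mvfderiv 𝓘(ℝ, E) (fun q => S.eta q (chartFrame x₀ q w)) x₀ (chartFrame x₀ x₀ v) := by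
  have hη : DifferentiableAt ℝ (etaChart S x₀) (extChartAt 𝓘(ℝ, E) x₀ x₀) :=
    ((contDiffOn_etaChart S x₀).contDiffAt (extChartAt_target_mem_nhds x₀)).differentiableAt
      (by simp)
  have h : (fun q => S.eta q (chartFrame x₀ q w)) ∘ (extChartAt 𝓘(ℝ, E) x₀).symm =
      fun x => etaChart S x₀ x w := funext fun x => (etaChart_apply S rfl w).symm
  rw [← fderiv_comp_extChartAt_symm
    ((contMDiffAt_eta_chartField S x₀ w (mem_chart_source E x₀)).mdifferentiableAt (by simp)), h,
    fderiv_clm_apply_const hη w v]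

lemma fderiv_bilinChart_inner_apply (g : RiemMetric 𝓘(ℝ, E) M) (x₀ : M) (v w u : E) :
    fderiv ℝ (bilinChart g.inner x₀) (extChartAt 𝓘(ℝ, E) x₀ x₀) v w u =
      mvfderiv 𝓘(ℝ, E) (fun q => g.inner q (chartFrame x₀ q w) (chartFrame x₀ q u)) x₀
        (chartFrame x₀ x₀ v) := by
  have hG : DifferentiableAt ℝ (bilinChart g.inner x₀) (extChartAt 𝓘(ℝ, E) x₀ x₀) :=
    ((contDiffOn_bilinChart x₀ fun v w _ hq =>
      contMDiffAt_metric_chartField g x₀ v w hq).contDiffAt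
        (extChartAt_target_mem_nhds x₀)).differentiableAt (by simp)
  have h : (fun q => g.inner q (chartFrame x₀ q w) (chartFrame x₀ q u)) ∘
      (extChartAt 𝓘(ℝ, E) x₀).symm = fun x => bilinChart g.inner x₀ x w u :=
    funext fun x => (bilinChart_apply g.inner rfl w u).symm
  rw [← fderiv_comp_extChartAt_symm
    ((contMDiffAt_metric_chartField g x₀ w u (mem_chart_source E x₀)).mdifferentiableAt (by simp)),
    h, fderiv_clm_apply_const₂ hG w u v]

lemma koszul_etaChart (hcov : IsLeviCivita g cov) {α β : M → ℝ} (hS : IsTransSasakian S cov α β)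
    (x₀ : M) {u : E} (hu : chartFrame x₀ x₀ u = S.xi x₀) (v w : E) :
    2 * fderiv ℝ (etaChart S x₀) (extChartAt 𝓘(ℝ, E) x₀ x₀) v w -
      (fderiv ℝ (bilinChart g.inner x₀) (extChartAt 𝓘(ℝ, E) x₀ x₀) v w u +
       fderiv ℝ (bilinChart g.inner x₀) (extChartAt 𝓘(ℝ, E) x₀ x₀) w v u -
       fderiv ℝ (bilinChart g.inner x₀) (extChartAt 𝓘(ℝ, E) x₀ x₀) u v w) =
    2 * (-(α x₀ * g.inner x₀ (S.phi x₀ (chartFrame x₀ x₀ v)) (chartFrame x₀ x₀ w)) +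
      β x₀ * (g.inner x₀ (chartFrame x₀ x₀ v) (chartFrame x₀ x₀ w) -
        S.eta x₀ (chartFrame x₀ x₀ v) * S.eta x₀ (chartFrame x₀ x₀ w))) := by
  have := FiniteDimensional.complete ℝ E
  have hs := mem_chart_source E x₀
  have hd (v : E) := (contMDiffAt_chartField x₀ v hs).mdifferentiableAt (by simp)
  have h := koszul_eta (X := chartField x₀ v) (Y := chartField x₀ w) (U := chartField x₀ u) hcov hS
    (hd v) (hd w) (hd u) (mlieBracket_chartField x₀ v w hs)
    (mlieBracket_chartField x₀ v u hs) (mlieBracket_chartField x₀ w u hs) hu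
  rw [fderiv_etaChart_apply, fderiv_bilinChart_inner_apply, fderiv_bilinChart_inner_apply,
    fderiv_bilinChart_inner_apply]
  exact h

/-- The covariant derivative of `η` along a map into the ambient manifold. -/
theorem koszul_eta_pullback (hcov : IsLeviCivita g cov) {α β : M → ℝ}
    (hS : IsTransSasakian S cov α β) (hW : IsOpen W)
    (hκ : ContMDiffOn 𝓘(ℝ, E') 𝓘(ℝ, E) ∞ κ W) {p : E'} (hp : p ∈ W) {w : E'}
    (hw : dmap 𝓘(ℝ, E) κ p w = S.xi (κ p)) (X Y : E') :
    2 * fderiv ℝ (fun q => S.eta (κ q) (dmap 𝓘(ℝ, E) κ q Y)) p X -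
      (fderiv ℝ (fun q => g.inner (κ q) (dmap 𝓘(ℝ, E) κ q Y) (dmap 𝓘(ℝ, E) κ q w)) p X +
       fderiv ℝ (fun q => g.inner (κ q) (dmap 𝓘(ℝ, E) κ q X) (dmap 𝓘(ℝ, E) κ q w)) p Y -
       fderiv ℝ (fun q => g.inner (κ q) (dmap 𝓘(ℝ, E) κ q X) (dmap 𝓘(ℝ, E) κ q Y)) p w) =
    2 * (-(α (κ p) * g.inner (κ p) (S.phi (κ p) (dmap 𝓘(ℝ, E) κ p X)) (dmap 𝓘(ℝ, E) κ p Y)) +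
      β (κ p) * (g.inner (κ p) (dmap 𝓘(ℝ, E) κ p X) (dmap 𝓘(ℝ, E) κ p Y) -
        S.eta (κ p) (dmap 𝓘(ℝ, E) κ p X) * S.eta (κ p) (dmap 𝓘(ℝ, E) κ p Y))) := by
  obtain ⟨hκp, hs⟩ := (eventually_chart hW hκ hp).self_of_nhds
  have hl : (extChartAt 𝓘(ℝ, E) (κ p)).symm (extChartAt 𝓘(ℝ, E) (κ p) (κ p)) = κ p :=
    extChartAt_to_inv (I := 𝓘(ℝ, E)) (κ p)
  have hF : ContDiffAt ℝ 2 (extChartAt 𝓘(ℝ, E) (κ p) ∘ κ) p :=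
    (contDiffAt_extChartAt_comp hW hκ hp).of_le ENat.LEInfty.out
  have hη : DifferentiableAt ℝ (etaChart S (κ p)) (extChartAt 𝓘(ℝ, E) (κ p) (κ p)) :=
    ((contDiffOn_etaChart S (κ p)).contDiffAt (extChartAt_target_mem_nhds (κ p))).differentiableAt
      (by simp)
  have hG : DifferentiableAt ℝ (bilinChart g.inner (κ p)) (extChartAt 𝓘(ℝ, E) (κ p) (κ p)) :=
    ((contDiffOn_bilinChart (κ p) fun v w _ hq =>
      contMDiffAt_metric_chartField g (κ p) v w hq).contDiffAt
        (extChartAt_target_mem_nhds (κ p))).differentiableAt (by simp)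
  have hw' := hw
  rw [dmap_eq_chartFrame hκp hs] at hw'
  have h := koszul_pullback hF hη hG
    (fun v w => by
      simp only [Function.comp_apply]
      rw [bilinChart_apply _ hl, bilinChart_apply _ hl, g.symm])
    (u := fderiv ℝ (extChartAt 𝓘(ℝ, E) (κ p) ∘ κ) p w)
    (fun v => by
      simp only [Function.comp_apply]
      rw [bilinChart_apply _ hl, etaChart_apply _ hl, hw', S.inner_xi]) rfl X Y
  rw [(eta_pullback_eventuallyEq S hW hκ hp Y).fderiv_eq,
    (bilin_pullback_eventuallyEq g.inner hW hκ hp Y w).fderiv_eq,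
    (bilin_pullback_eventuallyEq g.inner hW hκ hp X w).fderiv_eq,
    (bilin_pullback_eventuallyEq g.inner hW hκ hp X Y).fderiv_eq, h,
    dmap_eq_chartFrame hκp hs, dmap_eq_chartFrame hκp hs]
  -- The pull-back has become the same expression in the chart at `κ p`, where coordinate fields
  -- commute and the manifold identity applies.
  exact koszul_etaChart hcov hS (κ p) hw' _ _

end PullBack

/-! ### Product charts on `N₁ × N₂`. -/

section LocalProduct
open Filter Topology

/-- Consequences of the formula for `∇η` when `η` vanishes on the second of two orthogonal families
of directions. -/
lemma koszul_split {E' : Type*} [NormedAddCommGroup E'] [NormedSpace ℝ E'] {p w : E'}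
    {θ : E' → E' → ℝ} {h : E' → E' → E' → ℝ} {Φ : E' → E' → ℝ} {a b : ℝ} {A B : Set E'}
    (hK : ∀ X Y, 2 * fderiv ℝ (fun q => θ q Y) p X -
      (fderiv ℝ (fun q => h q Y w) p X + fderiv ℝ (fun q => h q X w) p Y -
        fderiv ℝ (fun q => h q X Y) p w) = 2 * (-(a * Φ X Y) + b * (h p X Y - θ p X * θ p Y)))
    (hw : w ∈ A) (hθ : ∀ Z ∈ B, (fun q => θ q Z) =ᶠ[𝓝 p] 0)
    (hAB : ∀ X ∈ A, ∀ Z ∈ B, (fun q => h q X Z) =ᶠ[𝓝 p] 0)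
    (hBA : ∀ X ∈ A, ∀ Z ∈ B, (fun q => h q Z X) =ᶠ[𝓝 p] 0)
    (hΦ₁ : ∀ X ∈ A, ∀ Z ∈ B, Φ X Z = 0) (hΦ₂ : ∀ X ∈ A, ∀ Z ∈ B, Φ Z X = 0) :
    (∀ X ∈ A, ∀ Z ∈ B, fderiv ℝ (fun q => θ q X) p Z = 0) ∧
    (∀ Z ∈ B, fderiv ℝ (fun q => h q w w) p Z = 0) ∧
    (∀ Z ∈ B, ∀ Z' ∈ B, fderiv ℝ (fun q => h q Z Z') p w =
      2 * (-(a * Φ Z Z') + b * h p Z Z')) := by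
  have dz {f : E' → ℝ} (hf : f =ᶠ[𝓝 p] 0) (v : E') : fderiv ℝ f p v = 0 := by
    rw [hf.fderiv_eq]; simp
  have hθp : ∀ Z ∈ B, θ p Z = 0 := fun Z hZ => (hθ Z hZ).self_of_nhds
  have hABp : ∀ X ∈ A, ∀ Z ∈ B, h p X Z = 0 := fun X hX Z hZ => (hAB X hX Z hZ).self_of_nhds
  have hBAp : ∀ X ∈ A, ∀ Z ∈ B, h p Z X = 0 := fun X hX Z hZ => (hBA X hX Z hZ).self_of_nhds
  -- In the identity for `(X, Z)` only `Z h(X, w)` survives; feeding this into the identity for `(Z,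
  -- X)` then leaves only `Z θ(X)`.
  have h1 : ∀ X ∈ A, ∀ Z ∈ B, fderiv ℝ (fun q => h q X w) p Z = 0 := by
    intro X hX Z hZ
    have := hK X Z
    rw [dz (hθ Z hZ), dz (hBA w hw Z hZ), dz (hAB X hX Z hZ), hΦ₁ X hX Z hZ,
      hθp Z hZ, hABp X hX Z hZ] at this
    linarith
  refine ⟨fun X hX Z hZ => ?_, h1 w hw, fun Z hZ Z' hZ' => ?_⟩
  · have := hK Z X
    rw [dz (hBA w hw Z hZ), dz (hBA X hX Z hZ), hΦ₂ X hX Z hZ, h1 X hX Z hZ,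
      hθp Z hZ, hBAp X hX Z hZ] at this
    linarith
  · have := hK Z Z'
    rw [dz (hBA w hw Z hZ), dz (hBA w hw Z' hZ'), dz (hθ Z' hZ'),
      hθp Z hZ] at this
    linarith

variable {E₁ E₂ : Type*} [NormedAddCommGroup E₁] [NormedSpace ℝ E₁]
  [NormedAddCommGroup E₂] [NormedSpace ℝ E₂]

lemma fderiv_sq_snd_mul_fst {c : E₂ → ℝ} {k : E₁ → ℝ} {q : E₁ × E₂}
    (hc : DifferentiableAt ℝ c q.2) (hk : DifferentiableAt ℝ k q.1) (Z : E₂) :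
    fderiv ℝ (fun q : E₁ × E₂ => c q.2 ^ 2 * k q.1) q (0, Z) =
      2 * c q.2 * fderiv ℝ c q.2 Z * k q.1 := by
  have h1 : HasFDerivAt (fun q : E₁ × E₂ => c q.2) _ q := hc.hasFDerivAt.comp q hasFDerivAt_snd
  have h2 : HasFDerivAt (fun q : E₁ × E₂ => k q.1) _ q := hk.hasFDerivAt.comp q hasFDerivAt_fst
  have h3 : HasFDerivAt (fun q : E₁ × E₂ => c q.2 ^ 2 * k q.1) _ q := (h1.pow 2).mul h2
  rw [h3.fderiv]
  simp
  ring

lemma fderiv_sq_fst_mul_snd {c : E₁ → ℝ} {k : E₂ → ℝ} {q : E₁ × E₂}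
    (hc : DifferentiableAt ℝ c q.1) (hk : DifferentiableAt ℝ k q.2) (X : E₁) :
    fderiv ℝ (fun q : E₁ × E₂ => c q.1 ^ 2 * k q.2) q (X, 0) =
      2 * c q.1 * fderiv ℝ c q.1 X * k q.2 := by
  have h1 : HasFDerivAt (fun q : E₁ × E₂ => c q.1) _ q := hc.hasFDerivAt.comp q hasFDerivAt_fst
  have h2 : HasFDerivAt (fun q : E₁ × E₂ => k q.2) _ q := hk.hasFDerivAt.comp q hasFDerivAt_snd
  have h3 : HasFDerivAt (fun q : E₁ × E₂ => c q.1 ^ 2 * k q.2) _ q := (h1.pow 2).mul h2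
  rw [h3.fderiv]
  simp
  ring

/-- A function on a connected manifold whose derivative vanishes in all charts is constant. -/
lemma eq_of_hasFDerivAt_chart_zero {N : Type*} [TopologicalSpace N] [PreconnectedSpace N]
    [ChartedSpace E₁ N] {f : N → ℝ}
    (hf : ∀ y₀ : N, ∀ x ∈ (extChartAt 𝓘(ℝ, E₁) y₀).target,
      HasFDerivAt (f ∘ (extChartAt 𝓘(ℝ, E₁) y₀).symm) (0 : E₁ →L[ℝ] ℝ) x) (y y' : N) :
    f y = f y' := by
  have hloc : IsLocallyConstant f := by
    rw [IsLocallyConstant.iff_eventually_eq]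
    intro y₀
    obtain ⟨r, hr, hball⟩ := Metric.mem_nhds_iff.1 (extChartAt_target_mem_nhds (I := 𝓘(ℝ, E₁)) y₀)
    filter_upwards [(continuousAt_extChartAt (I := 𝓘(ℝ, E₁)) y₀).preimage_mem_nhds
      (Metric.ball_mem_nhds _ hr), extChartAt_source_mem_nhds (I := 𝓘(ℝ, E₁)) y₀] with z hz hz'
    have := Metric.isOpen_ball.is_const_of_fderiv_eq_zero
      (convex_ball (extChartAt 𝓘(ℝ, E₁) y₀ y₀) r).isPreconnected
      (fun x hx => (hf y₀ x (hball hx)).differentiableAt.differentiableWithinAt)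
      (fun x hx => (hf y₀ x (hball hx)).fderiv) hz (Metric.mem_ball_self hr)
    simp only [Function.comp_apply] at this
    rwa [(extChartAt 𝓘(ℝ, E₁) y₀).left_inv hz', extChartAt_to_inv] at this
  exact hloc.apply_eq_of_preconnectedSpace y y'

variable {N₁ N₂ : Type*} [TopologicalSpace N₁] [ChartedSpace E₁ N₁]
  [TopologicalSpace N₂] [ChartedSpace E₂ N₂]

/-- The product of the inverses of the charts at `x₁` and `x₂`. -/
def prodChart (x₁ : N₁) (x₂ : N₂) (q : E₁ × E₂) : N₁ × N₂ :=
  ((extChartAt 𝓘(ℝ, E₁) x₁).symm q.1, (extChartAt 𝓘(ℝ, E₂) x₂).symm q.2)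

variable (E₁ E₂) in
/-- The domain of `prodChart`. -/
def prodTarget (x₁ : N₁) (x₂ : N₂) : Set (E₁ × E₂) :=
  (extChartAt 𝓘(ℝ, E₁) x₁).target ×ˢ (extChartAt 𝓘(ℝ, E₂) x₂).target

lemma isOpen_prodTarget (x₁ : N₁) (x₂ : N₂) : IsOpen (prodTarget E₁ E₂ x₁ x₂) :=
  (isOpen_extChartAt_target x₁).prod (isOpen_extChartAt_target x₂)

variable [IsManifold 𝓘(ℝ, E₁) ∞ N₁] [IsManifold 𝓘(ℝ, E₂) ∞ N₂]

lemma contMDiffOn_prodChart (x₁ : N₁) (x₂ : N₂) :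
    ContMDiffOn 𝓘(ℝ, E₁ × E₂) (𝓘(ℝ, E₁).prod 𝓘(ℝ, E₂)) ∞ (prodChart x₁ x₂)
      (prodTarget E₁ E₂ x₁ x₂) := by
  refine ContMDiffOn.prodMk ?_ ?_
  · exact (contMDiffOn_extChartAt_symm x₁).comp (contDiff_fst.contMDiff.contMDiffOn)
      fun q hq => hq.1
  · exact (contMDiffOn_extChartAt_symm x₂).comp (contDiff_snd.contMDiff.contMDiffOn)
      fun q hq => hq.2

lemma mdifferentiableAt_prodChart {x₁ : N₁} {x₂ : N₂} {q : E₁ × E₂}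
    (hq : q ∈ prodTarget E₁ E₂ x₁ x₂) :
    MDifferentiableAt 𝓘(ℝ, E₁ × E₂) (𝓘(ℝ, E₁).prod 𝓘(ℝ, E₂)) (prodChart x₁ x₂) q :=
  ((contMDiffOn_prodChart x₁ x₂).contMDiffAt
    ((isOpen_prodTarget x₁ x₂).mem_nhds hq)).mdifferentiableAt (by simp)

lemma mdifferentiableAt_extChartAt_symm (x₁ : N₁) {x : E₁}
    (hx : x ∈ (extChartAt 𝓘(ℝ, E₁) x₁).target) :
    MDifferentiableAt 𝓘(ℝ, E₁) 𝓘(ℝ, E₁) (extChartAt 𝓘(ℝ, E₁) x₁).symm x :=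
  ((contMDiffOn_extChartAt_symm (n := ∞) x₁).contMDiffAt
    ((isOpen_extChartAt_target x₁).mem_nhds hx)).mdifferentiableAt (by simp)

lemma mfderiv_fst_dmap_prodChart {x₁ : N₁} {x₂ : N₂} {q : E₁ × E₂}
    (hq : q ∈ prodTarget E₁ E₂ x₁ x₂) (X : E₁ × E₂) :
    mfderiv (𝓘(ℝ, E₁).prod 𝓘(ℝ, E₂)) 𝓘(ℝ, E₁) (Prod.fst : N₁ × N₂ → N₁) (prodChart x₁ x₂ q)
        (dmap (𝓘(ℝ, E₁).prod 𝓘(ℝ, E₂)) (prodChart x₁ x₂) q X) =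
      dmap 𝓘(ℝ, E₁) (extChartAt 𝓘(ℝ, E₁) x₁).symm q.1 X.1 := by
  rw [← dmap_comp mdifferentiableAt_fst (mdifferentiableAt_prodChart hq)]
  have h := dmap_comp_fderiv (L := Prod.fst) (mdifferentiableAt_extChartAt_symm x₁ hq.1)
    (differentiableAt_fst (p := q)) X
  rw [fderiv_fst] at h
  exact h

lemma mfderiv_snd_dmap_prodChart {x₁ : N₁} {x₂ : N₂} {q : E₁ × E₂}
    (hq : q ∈ prodTarget E₁ E₂ x₁ x₂) (X : E₁ × E₂) :
    mfderiv (𝓘(ℝ, E₁).prod 𝓘(ℝ, E₂)) 𝓘(ℝ, E₂) (Prod.snd : N₁ × N₂ → N₂) (prodChart x₁ x₂ q)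
        (dmap (𝓘(ℝ, E₁).prod 𝓘(ℝ, E₂)) (prodChart x₁ x₂) q X) =
      dmap 𝓘(ℝ, E₂) (extChartAt 𝓘(ℝ, E₂) x₂).symm q.2 X.2 := by
  rw [← dmap_comp mdifferentiableAt_snd (mdifferentiableAt_prodChart hq)]
  have h := dmap_comp_fderiv (L := Prod.snd) (mdifferentiableAt_extChartAt_symm x₂ hq.2)
    (differentiableAt_snd (p := q)) X
  rw [fderiv_snd] at h
  exact h

lemma exists_dmap_extChartAt_symm_eq (x₀ : N₁) {x : E₁}
    (hx : x ∈ (extChartAt 𝓘(ℝ, E₁) x₀).target)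
    (w : TangentSpace 𝓘(ℝ, E₁) ((extChartAt 𝓘(ℝ, E₁) x₀).symm x)) :
    ∃ v : E₁, dmap 𝓘(ℝ, E₁) (extChartAt 𝓘(ℝ, E₁) x₀).symm x v = w := by
  have hs := (extChartAt 𝓘(ℝ, E₁) x₀).map_target hx
  obtain ⟨v, hv⟩ := exists_chartFrame_eq x₀ (by simpa using hs) w
  exact ⟨v, by rw [dmap_extChartAt_symm x₀ hx, hv]⟩

omit [IsManifold 𝓘(ℝ, E₁) ∞ N₁] [IsManifold 𝓘(ℝ, E₂) ∞ N₂] in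
lemma tangent_prod_ext {p : N₁ × N₂} {u v : TangentSpace (𝓘(ℝ, E₁).prod 𝓘(ℝ, E₂)) p}
    (h₁ : mfderiv (𝓘(ℝ, E₁).prod 𝓘(ℝ, E₂)) 𝓘(ℝ, E₁) (Prod.fst : N₁ × N₂ → N₁) p u =
      mfderiv (𝓘(ℝ, E₁).prod 𝓘(ℝ, E₂)) 𝓘(ℝ, E₁) (Prod.fst : N₁ × N₂ → N₁) p v)
    (h₂ : mfderiv (𝓘(ℝ, E₁).prod 𝓘(ℝ, E₂)) 𝓘(ℝ, E₂) (Prod.snd : N₁ × N₂ → N₂) p u =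
      mfderiv (𝓘(ℝ, E₁).prod 𝓘(ℝ, E₂)) 𝓘(ℝ, E₂) (Prod.snd : N₁ × N₂ → N₂) p v) : u = v := by
  rw [mfderiv_fst] at h₁
  rw [mfderiv_snd] at h₂
  exact Prod.ext h₁ h₂

lemma exists_dmap_prodChart_eq {x₁ : N₁} {x₂ : N₂} {q : E₁ × E₂}
    (hq : q ∈ prodTarget E₁ E₂ x₁ x₂)
    (u : TangentSpace (𝓘(ℝ, E₁).prod 𝓘(ℝ, E₂)) (prodChart x₁ x₂ q)) :
    ∃ X : E₁ × E₂, dmap (𝓘(ℝ, E₁).prod 𝓘(ℝ, E₂)) (prodChart x₁ x₂) q X = u := by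
  obtain ⟨X₁, h₁⟩ := exists_dmap_extChartAt_symm_eq x₁ hq.1
    (mfderiv (𝓘(ℝ, E₁).prod 𝓘(ℝ, E₂)) 𝓘(ℝ, E₁) (Prod.fst : N₁ × N₂ → N₁) (prodChart x₁ x₂ q) u)
  obtain ⟨X₂, h₂⟩ := exists_dmap_extChartAt_symm_eq x₂ hq.2
    (mfderiv (𝓘(ℝ, E₁).prod 𝓘(ℝ, E₂)) 𝓘(ℝ, E₂) (Prod.snd : N₁ × N₂ → N₂) (prodChart x₁ x₂ q) u)
  refine ⟨(X₁, X₂), tangent_prod_ext ?_ ?_⟩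
  · rw [mfderiv_fst_dmap_prodChart hq]; exact h₁
  · rw [mfderiv_snd_dmap_prodChart hq]; exact h₂

lemma dmap_extChartAt_symm_injective (x₀ : N₁) {x : E₁}
    (hx : x ∈ (extChartAt 𝓘(ℝ, E₁) x₀).target) {v : E₁}
    (h : dmap 𝓘(ℝ, E₁) (extChartAt 𝓘(ℝ, E₁) x₀).symm x v = 0) : v = 0 := by
  have : IsManifold 𝓘(ℝ, E₁) 1 N₁ := IsManifold.of_le (n := ∞) (by simp)
  have h1 := mfderiv_extChartAt_comp_mfderivWithin_extChartAt_symm (I := 𝓘(ℝ, E₁)) hx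
  simp only [modelWithCornersSelf_coe, Set.range_id, mfderivWithin_univ] at h1
  have h2 := DFunLike.congr_fun h1 v
  have h3 := congrArg (mfderiv 𝓘(ℝ, E₁) 𝓘(ℝ, E₁) (extChartAt 𝓘(ℝ, E₁) x₀)
    ((extChartAt 𝓘(ℝ, E₁) x₀).symm x)) h
  rw [map_zero] at h3
  exact h2.symm.trans h3

end LocalProduct

/-! ### The formula for `∇η` on a doubly warped product. -/

section Warped
open Filter Topology

variable {E E₁ E₂ : Type*} [NormedAddCommGroup E] [NormedSpace ℝ E]
  [NormedAddCommGroup E₁] [NormedSpace ℝ E₁]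
  [NormedAddCommGroup E₂] [NormedSpace ℝ E₂]
  {M : Type*} [TopologicalSpace M] [ChartedSpace E M] [IsManifold 𝓘(ℝ, E) ∞ M]
  {g : RiemMetric 𝓘(ℝ, E) M}
  {N₁ : Type*} [TopologicalSpace N₁] [ChartedSpace E₁ N₁] [IsManifold 𝓘(ℝ, E₁) ∞ N₁]
  {N₂ : Type*} [TopologicalSpace N₂] [ChartedSpace E₂ N₂] [IsManifold 𝓘(ℝ, E₂) ∞ N₂]

/-- `ι` is an isometric immersion of a doubly warped product such that `φ` maps the tangent
vectors of each factor to vectors orthogonal to the other factor. Unlike in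
`IsDoublyWarpedContactCR`, the two factors play symmetric roles. -/
structure IsPhiOrthogonal (S : AlmostContactMetric g)
    (g₁ : RiemMetric 𝓘(ℝ, E₁) N₁) (g₂ : RiemMetric 𝓘(ℝ, E₂) N₂)
    (f₁ : N₁ → ℝ) (f₂ : N₂ → ℝ) (ι : N₁ × N₂ → M) : Prop where
  smooth_f₁ : ContMDiff 𝓘(ℝ, E₁) 𝓘(ℝ, ℝ) ∞ f₁
  smooth_f₂ : ContMDiff 𝓘(ℝ, E₂) 𝓘(ℝ, ℝ) ∞ f₂
  pos_f₁ : ∀ x, 0 < f₁ x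
  pos_f₂ : ∀ y, 0 < f₂ y
  smooth_map : ContMDiff (𝓘(ℝ, E₁).prod 𝓘(ℝ, E₂)) 𝓘(ℝ, E) ∞ ι
  isometric : ∀ (p : N₁ × N₂) (u v : TangentSpace (𝓘(ℝ, E₁).prod 𝓘(ℝ, E₂)) p),
    g.inner (ι p) (mfderiv (𝓘(ℝ, E₁).prod 𝓘(ℝ, E₂)) 𝓘(ℝ, E) ι p u)
      (mfderiv (𝓘(ℝ, E₁).prod 𝓘(ℝ, E₂)) 𝓘(ℝ, E) ι p v) =
      doublyWarpedInner g₁ g₂ f₁ f₂ p u v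
  orthogonal : ∀ p : N₁ × N₂, ∀ u ∈ tangentFst 𝓘(ℝ, E₁) 𝓘(ℝ, E₂) p,
    ∀ v ∈ tangentSnd 𝓘(ℝ, E₁) 𝓘(ℝ, E₂) p,
      g.inner (ι p) (S.phi (ι p) (mfderiv (𝓘(ℝ, E₁).prod 𝓘(ℝ, E₂)) 𝓘(ℝ, E) ι p u))
        (mfderiv (𝓘(ℝ, E₁).prod 𝓘(ℝ, E₂)) 𝓘(ℝ, E) ι p v) = 0

variable {S : AlmostContactMetric g} {g₁ : RiemMetric 𝓘(ℝ, E₁) N₁} {g₂ : RiemMetric 𝓘(ℝ, E₂) N₂}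
  {f₁ : N₁ → ℝ} {f₂ : N₂ → ℝ} {ι : N₁ × N₂ → M}

namespace IsPhiOrthogonal

lemma mdifferentiableAt (hι : IsPhiOrthogonal S g₁ g₂ f₁ f₂ ι) (p : N₁ × N₂) :
    MDifferentiableAt (𝓘(ℝ, E₁).prod 𝓘(ℝ, E₂)) 𝓘(ℝ, E) ι p :=
  (hι.smooth_map p).mdifferentiableAt (by simp)

lemma dmap_comp_prodChart (hι : IsPhiOrthogonal S g₁ g₂ f₁ f₂ ι) {x₁ : N₁} {x₂ : N₂}
    {q : E₁ × E₂} (hq : q ∈ prodTarget E₁ E₂ x₁ x₂) (X : E₁ × E₂) :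
    dmap 𝓘(ℝ, E) (ι ∘ prodChart x₁ x₂) q X =
      mfderiv (𝓘(ℝ, E₁).prod 𝓘(ℝ, E₂)) 𝓘(ℝ, E) ι (prodChart x₁ x₂ q)
        (dmap (𝓘(ℝ, E₁).prod 𝓘(ℝ, E₂)) (prodChart x₁ x₂) q X) :=
  dmap_comp (hι.mdifferentiableAt _) (mdifferentiableAt_prodChart hq) X

lemma contMDiffOn_comp_prodChart (hι : IsPhiOrthogonal S g₁ g₂ f₁ f₂ ι) (x₁ : N₁) (x₂ : N₂) :
    ContMDiffOn 𝓘(ℝ, E₁ × E₂) 𝓘(ℝ, E) ∞ (ι ∘ prodChart x₁ x₂) (prodTarget E₁ E₂ x₁ x₂) :=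
  hι.smooth_map.comp_contMDiffOn (contMDiffOn_prodChart x₁ x₂)

lemma inner_dmap (hι : IsPhiOrthogonal S g₁ g₂ f₁ f₂ ι) {x₁ : N₁} {x₂ : N₂}
    {q : E₁ × E₂} (hq : q ∈ prodTarget E₁ E₂ x₁ x₂) (X Y : E₁ × E₂) :
    g.inner ((ι ∘ prodChart x₁ x₂) q) (dmap 𝓘(ℝ, E) (ι ∘ prodChart x₁ x₂) q X)
      (dmap 𝓘(ℝ, E) (ι ∘ prodChart x₁ x₂) q Y) =
    f₂ ((extChartAt 𝓘(ℝ, E₂) x₂).symm q.2) ^ 2 *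
      g₁.inner ((extChartAt 𝓘(ℝ, E₁) x₁).symm q.1)
        (dmap 𝓘(ℝ, E₁) (extChartAt 𝓘(ℝ, E₁) x₁).symm q.1 X.1)
        (dmap 𝓘(ℝ, E₁) (extChartAt 𝓘(ℝ, E₁) x₁).symm q.1 Y.1) +
    f₁ ((extChartAt 𝓘(ℝ, E₁) x₁).symm q.1) ^ 2 *
      g₂.inner ((extChartAt 𝓘(ℝ, E₂) x₂).symm q.2)
        (dmap 𝓘(ℝ, E₂) (extChartAt 𝓘(ℝ, E₂) x₂).symm q.2 X.2)
        (dmap 𝓘(ℝ, E₂) (extChartAt 𝓘(ℝ, E₂) x₂).symm q.2 Y.2) := by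
  rw [hι.dmap_comp_prodChart hq, hι.dmap_comp_prodChart hq]
  refine (hι.isometric _ _ _).trans ?_
  rw [doublyWarpedInner, mfderiv_fst_dmap_prodChart hq, mfderiv_snd_dmap_prodChart hq,
    mfderiv_fst_dmap_prodChart hq, mfderiv_snd_dmap_prodChart hq]
  rfl

lemma dmap_mem_tangentFst {x₁ : N₁} {x₂ : N₂} {q : E₁ × E₂}
    (hq : q ∈ prodTarget E₁ E₂ x₁ x₂) (X : E₁) :
    dmap (𝓘(ℝ, E₁).prod 𝓘(ℝ, E₂)) (prodChart x₁ x₂) q (X, 0) ∈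
      tangentFst 𝓘(ℝ, E₁) 𝓘(ℝ, E₂) (prodChart x₁ x₂ q) := by
  rw [tangentFst, LinearMap.mem_ker]
  exact (mfderiv_snd_dmap_prodChart hq (X, 0)).trans (map_zero _)

lemma dmap_mem_tangentSnd {x₁ : N₁} {x₂ : N₂} {q : E₁ × E₂}
    (hq : q ∈ prodTarget E₁ E₂ x₁ x₂) (Z : E₂) :
    dmap (𝓘(ℝ, E₁).prod 𝓘(ℝ, E₂)) (prodChart x₁ x₂) q (0, Z) ∈
      tangentSnd 𝓘(ℝ, E₁) 𝓘(ℝ, E₂) (prodChart x₁ x₂ q) := by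
  rw [tangentSnd, LinearMap.mem_ker]
  exact (mfderiv_fst_dmap_prodChart hq (0, Z)).trans (map_zero _)

lemma eta_eq_zero_of_mem_tangentSnd (hι : IsPhiOrthogonal S g₁ g₂ f₁ f₂ ι)
    (hξ : XiTangentFst 𝓘(ℝ, E₁) 𝓘(ℝ, E₂) S ι) {p : N₁ × N₂}
    {u : TangentSpace (𝓘(ℝ, E₁).prod 𝓘(ℝ, E₂)) p} (hu : u ∈ tangentSnd 𝓘(ℝ, E₁) 𝓘(ℝ, E₂) p) :
    S.eta (ι p) (mfderiv (𝓘(ℝ, E₁).prod 𝓘(ℝ, E₂)) 𝓘(ℝ, E) ι p u) = 0 := by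
  obtain ⟨w, hw, hwξ⟩ := hξ p
  rw [tangentSnd, LinearMap.mem_ker] at hu
  rw [tangentFst, LinearMap.mem_ker] at hw
  change mfderiv _ _ _ _ _ = 0 at hu hw
  rw [← S.inner_xi, ← hwξ, hι.isometric, doublyWarpedInner, hu, hw]
  simp only [map_zero, zero_apply, mul_zero, add_zero]

variable [FiniteDimensional ℝ E] [FiniteDimensional ℝ E₁] [FiniteDimensional ℝ E₂]
  {cov : CovariantDerivative 𝓘(ℝ, E) E (TangentSpace 𝓘(ℝ, E) : M → Type _)} {α β : M → ℝ}

/-- This is `koszul_split` with the directions of `N₁` as `A`, containing `ξ`, and those of `N₂` as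
`B`. The three conclusions are its three conclusions with the warped metric written out. -/
lemma local_identities (hι : IsPhiOrthogonal S g₁ g₂ f₁ f₂ ι) (hcov : IsLeviCivita g cov)
    (hS : IsTransSasakian S cov α β) (hξ : XiTangentFst 𝓘(ℝ, E₁) 𝓘(ℝ, E₂) S ι)
    {x₁ : N₁} {x₂ : N₂} {q : E₁ × E₂} (hq : q ∈ prodTarget E₁ E₂ x₁ x₂) :
    (∀ (X : E₁) (Z : E₂), fderiv ℝ (fun q => S.eta ((ι ∘ prodChart x₁ x₂) q)
      (dmap 𝓘(ℝ, E) (ι ∘ prodChart x₁ x₂) q (X, 0))) q (0, Z) = 0) ∧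
    (∀ Z : E₂, fderiv ℝ (f₂ ∘ (extChartAt 𝓘(ℝ, E₂) x₂).symm) q.2 Z = 0) ∧
    ∃ w₁ : E₁, dmap 𝓘(ℝ, E) (ι ∘ prodChart x₁ x₂) q (w₁, 0) = S.xi ((ι ∘ prodChart x₁ x₂) q) ∧
      ∀ Z Z' : E₂, 2 * f₁ ((extChartAt 𝓘(ℝ, E₁) x₁).symm q.1) *
          fderiv ℝ (f₁ ∘ (extChartAt 𝓘(ℝ, E₁) x₁).symm) q.1 w₁ *
          g₂.inner ((extChartAt 𝓘(ℝ, E₂) x₂).symm q.2)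
            (dmap 𝓘(ℝ, E₂) (extChartAt 𝓘(ℝ, E₂) x₂).symm q.2 Z)
            (dmap 𝓘(ℝ, E₂) (extChartAt 𝓘(ℝ, E₂) x₂).symm q.2 Z') =
        2 * (-(α ((ι ∘ prodChart x₁ x₂) q) * g.inner ((ι ∘ prodChart x₁ x₂) q)
            (S.phi ((ι ∘ prodChart x₁ x₂) q)
              (dmap 𝓘(ℝ, E) (ι ∘ prodChart x₁ x₂) q (0, Z)))
            (dmap 𝓘(ℝ, E) (ι ∘ prodChart x₁ x₂) q (0, Z'))) +
          β ((ι ∘ prodChart x₁ x₂) q) * (f₁ ((extChartAt 𝓘(ℝ, E₁) x₁).symm q.1) ^ 2 *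
            g₂.inner ((extChartAt 𝓘(ℝ, E₂) x₂).symm q.2)
              (dmap 𝓘(ℝ, E₂) (extChartAt 𝓘(ℝ, E₂) x₂).symm q.2 Z)
              (dmap 𝓘(ℝ, E₂) (extChartAt 𝓘(ℝ, E₂) x₂).symm q.2 Z'))) := by
  have hWo := isOpen_prodTarget (E₁ := E₁) (E₂ := E₂) x₁ x₂
  have hκ := hι.contMDiffOn_comp_prodChart x₁ x₂
  obtain ⟨w', hw', hwξ'⟩ := hξ (prodChart x₁ x₂ q)
  obtain ⟨⟨w₁, w₂⟩, rfl⟩ := exists_dmap_prodChart_eq hq w'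
  have hw₂ : w₂ = 0 := by
    rw [tangentFst, LinearMap.mem_ker] at hw'
    exact dmap_extChartAt_symm_injective x₂ hq.2
      ((mfderiv_snd_dmap_prodChart hq (w₁, w₂)).symm.trans hw')
  subst hw₂
  have hwξ : dmap 𝓘(ℝ, E) (ι ∘ prodChart x₁ x₂) q (w₁, 0) = S.xi ((ι ∘ prodChart x₁ x₂) q) :=
    (hι.dmap_comp_prodChart hq _).trans hwξ'
  have hev {f f' : E₁ × E₂ → ℝ} (h : ∀ q ∈ prodTarget E₁ E₂ x₁ x₂, f q = f' q) : f =ᶠ[𝓝 q] f' := by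
    filter_upwards [hWo.mem_nhds hq] with q hq using h q hq
  -- The vector `(w₁, 0)` is frozen: it represents `ξ` at `q` but in general not at nearby points.
  -- So the length of its image may vary, which is what detects the derivative of `f₂`.
  obtain ⟨h1, h2, h3⟩ := koszul_split (p := q) (w := (w₁, 0))
    (θ := fun q X => S.eta ((ι ∘ prodChart x₁ x₂) q) (dmap 𝓘(ℝ, E) (ι ∘ prodChart x₁ x₂) q X))
    (h := fun q X Y => g.inner ((ι ∘ prodChart x₁ x₂) q)
      (dmap 𝓘(ℝ, E) (ι ∘ prodChart x₁ x₂) q X) (dmap 𝓘(ℝ, E) (ι ∘ prodChart x₁ x₂) q Y))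
    (Φ := fun X Y => g.inner ((ι ∘ prodChart x₁ x₂) q) (S.phi ((ι ∘ prodChart x₁ x₂) q)
      (dmap 𝓘(ℝ, E) (ι ∘ prodChart x₁ x₂) q X)) (dmap 𝓘(ℝ, E) (ι ∘ prodChart x₁ x₂) q Y))
    (A := Set.range fun X : E₁ => (X, (0 : E₂))) (B := Set.range fun Z : E₂ => ((0 : E₁), Z))
    (fun X Y => koszul_eta_pullback hcov hS hWo hκ hq hwξ X Y) ⟨w₁, rfl⟩
    (by
      rintro _ ⟨Z, rfl⟩
      refine hev fun q hq => ?_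
      rw [hι.dmap_comp_prodChart hq]
      exact hι.eta_eq_zero_of_mem_tangentSnd hξ (dmap_mem_tangentSnd hq Z))
    (by
      rintro _ ⟨X, rfl⟩ _ ⟨Z, rfl⟩
      refine hev fun q hq => ?_
      simp only [hι.inner_dmap hq, map_zero, zero_apply, mul_zero, add_zero, Pi.zero_apply])
    (by
      rintro _ ⟨X, rfl⟩ _ ⟨Z, rfl⟩
      refine hev fun q hq => ?_
      simp only [hι.inner_dmap hq, map_zero, zero_apply, mul_zero, add_zero, Pi.zero_apply])
    (by
      rintro _ ⟨X, rfl⟩ _ ⟨Z, rfl⟩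
      simp only [hι.dmap_comp_prodChart hq]
      exact hι.orthogonal _ _ (dmap_mem_tangentFst hq X) _ (dmap_mem_tangentSnd hq Z))
    (by
      rintro _ ⟨X, rfl⟩ _ ⟨Z, rfl⟩
      simp only [hι.dmap_comp_prodChart hq]
      rw [S.inner_phi_left, g.symm, neg_eq_zero]
      exact hι.orthogonal _ _ (dmap_mem_tangentFst hq X) _ (dmap_mem_tangentSnd hq Z))
  have hc₁ : DifferentiableAt ℝ (f₁ ∘ (extChartAt 𝓘(ℝ, E₁) x₁).symm) q.1 :=
    ((hι.smooth_f₁ _).mdifferentiableAt (by simp)).comp q.1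
      (mdifferentiableAt_extChartAt_symm x₁ hq.1) |>.differentiableAt
  have hc₂ : DifferentiableAt ℝ (f₂ ∘ (extChartAt 𝓘(ℝ, E₂) x₂).symm) q.2 :=
    ((hι.smooth_f₂ _).mdifferentiableAt (by simp)).comp q.2
      (mdifferentiableAt_extChartAt_symm x₂ hq.2) |>.differentiableAt
  refine ⟨fun X Z => h1 _ ⟨X, rfl⟩ _ ⟨Z, rfl⟩, fun Z => ?_, w₁, hwξ, fun Z Z' => ?_⟩
  · have hk := ((contDiffOn_metric_pullback g₁ (isOpen_extChartAt_target x₁)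
      (contMDiffOn_extChartAt_symm x₁) w₁ w₁).contDiffAt
        ((isOpen_extChartAt_target x₁).mem_nhds hq.1)).differentiableAt (by simp)
    have h4 := h2 _ ⟨Z, rfl⟩
    rw [(hev (f' := fun q => (f₂ ∘ (extChartAt 𝓘(ℝ, E₂) x₂).symm) q.2 ^ 2 *
      g₁.inner ((extChartAt 𝓘(ℝ, E₁) x₁).symm q.1)
        (dmap 𝓘(ℝ, E₁) (extChartAt 𝓘(ℝ, E₁) x₁).symm q.1 w₁)
        (dmap 𝓘(ℝ, E₁) (extChartAt 𝓘(ℝ, E₁) x₁).symm q.1 w₁)) fun q hq => by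
          refine (hι.inner_dmap hq _ _).trans ?_
          simp only [map_zero, mul_zero, add_zero, Function.comp_apply]).fderiv_eq,
      fderiv_sq_snd_mul_fst hc₂ hk] at h4
    -- At `q` itself the vector is `ξ`, of length one. Hence `g₁(w₁, w₁) ≠ 0`, and it can be
    -- cancelled from the vanishing derivative of `f₂² g₁(w₁, w₁)`.
    have h5 := hι.inner_dmap hq (w₁, 0) (w₁, 0)
    rw [hwξ, S.inner_xi, S.eta_xi] at h5
    simp only [map_zero, mul_zero, add_zero] at h5
    have h6 := hι.pos_f₂ ((extChartAt 𝓘(ℝ, E₂) x₂).symm q.2)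
    rcases mul_eq_zero.1 h4 with h7 | h7
    · rcases mul_eq_zero.1 h7 with h8 | h8
      · simp only [Function.comp_apply] at h8; linarith
      · exact h8
    · rw [h7] at h5; simp at h5
  · have hk := ((contDiffOn_metric_pullback g₂ (isOpen_extChartAt_target x₂)
      (contMDiffOn_extChartAt_symm x₂) Z Z').contDiffAt
        ((isOpen_extChartAt_target x₂).mem_nhds hq.2)).differentiableAt (by simp)
    have h4 := h3 _ ⟨Z, rfl⟩ _ ⟨Z', rfl⟩
    rw [(hev (f' := fun q => (f₁ ∘ (extChartAt 𝓘(ℝ, E₁) x₁).symm) q.1 ^ 2 *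
      g₂.inner ((extChartAt 𝓘(ℝ, E₂) x₂).symm q.2)
        (dmap 𝓘(ℝ, E₂) (extChartAt 𝓘(ℝ, E₂) x₂).symm q.2 Z)
        (dmap 𝓘(ℝ, E₂) (extChartAt 𝓘(ℝ, E₂) x₂).symm q.2 Z')) fun q hq => by
          refine (hι.inner_dmap hq _ _).trans ?_
          simp only [map_zero, mul_zero, zero_add, Function.comp_apply]).fderiv_eq,
      fderiv_sq_fst_mul_snd hc₁ hk] at h4
    refine h4.trans ?_
    simp only [hι.inner_dmap hq, map_zero, mul_zero, zero_add]

end IsPhiOrthogonal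
end Warped

/-! ### Global consequences when `ξ` is tangent to the first factor. -/

section WarpedGlobal
open Filter Topology

variable {E E₁ E₂ : Type*} [NormedAddCommGroup E] [NormedSpace ℝ E]
  [NormedAddCommGroup E₁] [NormedSpace ℝ E₁] [NormedAddCommGroup E₂] [NormedSpace ℝ E₂]
  {M : Type*} [TopologicalSpace M] [ChartedSpace E M] [IsManifold 𝓘(ℝ, E) ∞ M]
  {g : RiemMetric 𝓘(ℝ, E) M}
  {N₁ : Type*} [TopologicalSpace N₁] [ChartedSpace E₁ N₁] [IsManifold 𝓘(ℝ, E₁) ∞ N₁]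
  {N₂ : Type*} [TopologicalSpace N₂] [ChartedSpace E₂ N₂] [IsManifold 𝓘(ℝ, E₂) ∞ N₂]
  {S : AlmostContactMetric g} {g₁ : RiemMetric 𝓘(ℝ, E₁) N₁} {g₂ : RiemMetric 𝓘(ℝ, E₂) N₂}
  {f₁ : N₁ → ℝ} {f₂ : N₂ → ℝ} {ι : N₁ × N₂ → M}

lemma inner_self_nonneg {H : Type*} [TopologicalSpace H] {I : ModelWithCorners ℝ E H}
    {M : Type*} [TopologicalSpace M] [ChartedSpace H M] [IsManifold I ∞ M]
    (g : RiemMetric I M) {p : M} (u : TangentSpace I p) : 0 ≤ g.inner p u u := by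
  by_cases hu : u = 0
  · rw [hu, map_zero]
  · exact (g.pos p u hu).le

lemma inner_self_eq_zero {H : Type*} [TopologicalSpace H] {I : ModelWithCorners ℝ E H}
    {M : Type*} [TopologicalSpace M] [ChartedSpace H M] [IsManifold I ∞ M]
    (g : RiemMetric I M) {p : M} {u : TangentSpace I p} (h : g.inner p u u = 0) : u = 0 := by
  by_contra hu
  exact (g.pos p u hu).ne' h

omit [IsManifold 𝓘(ℝ, E₁) ∞ N₁] [IsManifold 𝓘(ℝ, E₂) ∞ N₂] in
lemma exists_prodChart_eq (p : N₁ × N₂) :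
    ∃ (x₁ : N₁) (x₂ : N₂), ∃ q ∈ prodTarget E₁ E₂ x₁ x₂, prodChart x₁ x₂ q = p := by
  refine ⟨p.1, p.2, (extChartAt 𝓘(ℝ, E₁) p.1 p.1, extChartAt 𝓘(ℝ, E₂) p.2 p.2),
    ⟨mem_extChartAt_target p.1, mem_extChartAt_target p.2⟩, ?_⟩
  exact Prod.ext (extChartAt_to_inv p.1) (extChartAt_to_inv p.2)

namespace IsPhiOrthogonal

/-- A map preserving positive definite metrics is an immersion. -/
lemma eq_zero_of_mfderiv_eq_zero (hι : IsPhiOrthogonal S g₁ g₂ f₁ f₂ ι) {p : N₁ × N₂}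
    {u : TangentSpace (𝓘(ℝ, E₁).prod 𝓘(ℝ, E₂)) p}
    (hu : mfderiv (𝓘(ℝ, E₁).prod 𝓘(ℝ, E₂)) 𝓘(ℝ, E) ι p u = 0) : u = 0 := by
  have h := hι.isometric p u u
  rw [hu, map_zero, doublyWarpedInner] at h
  have h1 := inner_self_nonneg g₁
    (mfderiv (𝓘(ℝ, E₁).prod 𝓘(ℝ, E₂)) 𝓘(ℝ, E₁) (Prod.fst : N₁ × N₂ → N₁) p u)
  have h2 := inner_self_nonneg g₂
    (mfderiv (𝓘(ℝ, E₁).prod 𝓘(ℝ, E₂)) 𝓘(ℝ, E₂) (Prod.snd : N₁ × N₂ → N₂) p u)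
  have h3 := pow_pos (hι.pos_f₂ p.2) 2
  have h4 := pow_pos (hι.pos_f₁ p.1) 2
  obtain ⟨h5, h6⟩ :=
    (add_eq_zero_iff_of_nonneg (mul_nonneg h3.le h1) (mul_nonneg h4.le h2)).1 h.symm
  refine tangent_prod_ext ?_ ?_
  · rw [inner_self_eq_zero g₁ ((mul_eq_zero.1 h5).resolve_left h3.ne'), map_zero]
  · rw [inner_self_eq_zero g₂ ((mul_eq_zero.1 h6).resolve_left h4.ne'), map_zero]

lemma eq_of_mfderiv_eq (hι : IsPhiOrthogonal S g₁ g₂ f₁ f₂ ι) {p : N₁ × N₂}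
    {u v : TangentSpace (𝓘(ℝ, E₁).prod 𝓘(ℝ, E₂)) p}
    (huv : mfderiv (𝓘(ℝ, E₁).prod 𝓘(ℝ, E₂)) 𝓘(ℝ, E) ι p u =
      mfderiv (𝓘(ℝ, E₁).prod 𝓘(ℝ, E₂)) 𝓘(ℝ, E) ι p v) : u = v :=
  sub_eq_zero.1 (hι.eq_zero_of_mfderiv_eq_zero (by rw [map_sub, huv, sub_self]))

variable [FiniteDimensional ℝ E] [FiniteDimensional ℝ E₁] [FiniteDimensional ℝ E₂]
  {cov : CovariantDerivative 𝓘(ℝ, E) E (TangentSpace 𝓘(ℝ, E) : M → Type _)} {α β : M → ℝ}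

lemma warping_snd_const [Nonempty N₁] [PreconnectedSpace N₂]
    (hι : IsPhiOrthogonal S g₁ g₂ f₁ f₂ ι) (hcov : IsLeviCivita g cov)
    (hS : IsTransSasakian S cov α β) (hξ : XiTangentFst 𝓘(ℝ, E₁) 𝓘(ℝ, E₂) S ι) (y y' : N₂) :
    f₂ y = f₂ y' := by
  obtain ⟨x⟩ := ‹Nonempty N₁›
  refine eq_of_hasFDerivAt_chart_zero (E₁ := E₂) (fun y₀ z hz => ?_) y y'
  have hd : DifferentiableAt ℝ (f₂ ∘ (extChartAt 𝓘(ℝ, E₂) y₀).symm) z :=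
    ((hι.smooth_f₂ _).mdifferentiableAt (by simp)).comp z
      (mdifferentiableAt_extChartAt_symm y₀ hz) |>.differentiableAt
  refine hd.hasFDerivAt.congr_fderiv ?_
  ext Z
  exact (hι.local_identities hcov hS hξ (x₁ := x) (x₂ := y₀)
    (q := (extChartAt 𝓘(ℝ, E₁) x x, z)) ⟨mem_extChartAt_target x, hz⟩).2.1 Z

lemma mul_inner_phi_eq_zero (hι : IsPhiOrthogonal S g₁ g₂ f₁ f₂ ι) (hcov : IsLeviCivita g cov)
    (hS : IsTransSasakian S cov α β) (hξ : XiTangentFst 𝓘(ℝ, E₁) 𝓘(ℝ, E₂) S ι) {p : N₁ × N₂}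
    {u v : TangentSpace (𝓘(ℝ, E₁).prod 𝓘(ℝ, E₂)) p}
    (hu : u ∈ tangentSnd 𝓘(ℝ, E₁) 𝓘(ℝ, E₂) p) (hv : v ∈ tangentSnd 𝓘(ℝ, E₁) 𝓘(ℝ, E₂) p) :
    α (ι p) * g.inner (ι p)
      (S.phi (ι p) (mfderiv (𝓘(ℝ, E₁).prod 𝓘(ℝ, E₂)) 𝓘(ℝ, E) ι p u))
      (mfderiv (𝓘(ℝ, E₁).prod 𝓘(ℝ, E₂)) 𝓘(ℝ, E) ι p v) = 0 := by
  obtain ⟨x₁, x₂, q, hq, rfl⟩ := exists_prodChart_eq (E₁ := E₁) (E₂ := E₂) p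
  obtain ⟨⟨U₁, U₂⟩, rfl⟩ := exists_dmap_prodChart_eq hq u
  obtain ⟨⟨V₁, V₂⟩, rfl⟩ := exists_dmap_prodChart_eq hq v
  rw [tangentSnd, LinearMap.mem_ker] at hu hv
  obtain rfl : U₁ = 0 := dmap_extChartAt_symm_injective x₁ hq.1
    ((mfderiv_fst_dmap_prodChart hq _).symm.trans hu)
  obtain rfl : V₁ = 0 := dmap_extChartAt_symm_injective x₁ hq.1
    ((mfderiv_fst_dmap_prodChart hq _).symm.trans hv)
  obtain ⟨w₁, -, h⟩ := (hι.local_identities hcov hS hξ hq).2.2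
  -- Exchanging the two vectors changes only the sign of the term with `φ`, so subtracting isolates
  -- it.
  have h1 := h U₂ V₂
  have h2 := h V₂ U₂
  rw [S.inner_phi_left, g.symm, g₂.symm] at h2
  rw [← hι.dmap_comp_prodChart hq, ← hι.dmap_comp_prodChart hq]
  simp only [Function.comp_apply] at h1 h2 ⊢
  linarith

lemma mvfderiv_log_eq [Nontrivial E₂] (hι : IsPhiOrthogonal S g₁ g₂ f₁ f₂ ι)
    (hcov : IsLeviCivita g cov) (hS : IsTransSasakian S cov α β)
    (hξ : XiTangentFst 𝓘(ℝ, E₁) 𝓘(ℝ, E₂) S ι) {p : N₁ × N₂}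
    {w : TangentSpace (𝓘(ℝ, E₁).prod 𝓘(ℝ, E₂)) p}
    (hw : mfderiv (𝓘(ℝ, E₁).prod 𝓘(ℝ, E₂)) 𝓘(ℝ, E) ι p w = S.xi (ι p)) :
    mvfderiv 𝓘(ℝ, E₁) (fun x => Real.log (f₁ x)) p.1
      (mfderiv (𝓘(ℝ, E₁).prod 𝓘(ℝ, E₂)) 𝓘(ℝ, E₁) (Prod.fst : N₁ × N₂ → N₁) p w) = β (ι p) := by
  obtain ⟨x₁, x₂, q, hq, rfl⟩ := exists_prodChart_eq (E₁ := E₁) (E₂ := E₂) p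
  obtain ⟨w₁, hwξ, h⟩ := (hι.local_identities hcov hS hξ hq).2.2
  obtain rfl : w = dmap (𝓘(ℝ, E₁).prod 𝓘(ℝ, E₂)) (prodChart x₁ x₂) q (w₁, 0) :=
    hι.eq_of_mfderiv_eq ((hw.trans hwξ.symm).trans (hι.dmap_comp_prodChart hq _))
  rw [mfderiv_fst_dmap_prodChart hq]
  -- On the diagonal pair `(Z, Z)` the term with `α` vanishes by skew-symmetry of `φ`, and `g₂(Z, Z)
  -- > 0` can be cancelled.
  obtain ⟨Z, hZ⟩ := exists_ne (0 : E₂)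
  have hG := g₂.pos _ _ (fun h0 => hZ (dmap_extChartAt_symm_injective x₂ hq.2 h0))
  have hskew := S.inner_phi_left ((ι ∘ prodChart x₁ x₂) q)
    (dmap 𝓘(ℝ, E) (ι ∘ prodChart x₁ x₂) q (0, Z)) (dmap 𝓘(ℝ, E) (ι ∘ prodChart x₁ x₂) q (0, Z))
  rw [g.symm _ _ (S.phi _ _)] at hskew
  have h1 := h Z Z
  have hf := hι.pos_f₁ ((extChartAt 𝓘(ℝ, E₁) x₁).symm q.1)
  have hψ := mdifferentiableAt_extChartAt_symm x₁ hq.1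
  have hm : MDifferentiableAt 𝓘(ℝ, E₁) 𝓘(ℝ, ℝ) f₁ ((extChartAt 𝓘(ℝ, E₁) x₁).symm q.1) :=
    (hι.smooth_f₁ _).mdifferentiableAt (by simp)
  have hc₁ : DifferentiableAt ℝ (f₁ ∘ (extChartAt 𝓘(ℝ, E₁) x₁).symm) q.1 :=
    (hm.comp q.1 hψ).differentiableAt
  have hlog : MDifferentiableAt 𝓘(ℝ, E₁) 𝓘(ℝ, ℝ) (Real.log ∘ f₁)
      ((extChartAt 𝓘(ℝ, E₁) x₁).symm q.1) :=
    (Real.differentiableAt_log hf.ne').mdifferentiableAt.comp _ hm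
  refine (fderiv_comp_eq_mvfderiv hlog hψ w₁).symm.trans ?_
  have h2 := hc₁.hasFDerivAt.log hf.ne'
  refine (DFunLike.congr_fun h2.fderiv w₁).trans ?_
  rw [smul_apply, smul_eq_mul]
  have h3 : fderiv ℝ (f₁ ∘ (extChartAt 𝓘(ℝ, E₁) x₁).symm) q.1 w₁ =
      β ((ι ∘ prodChart x₁ x₂) q) * f₁ ((extChartAt 𝓘(ℝ, E₁) x₁).symm q.1) := by
    refine mul_left_cancel₀ (mul_pos (mul_pos two_pos hf) hG).ne' ?_
    linear_combination h1 - α ((ι ∘ prodChart x₁ x₂) q) * hskew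
  rw [h3, Function.comp_apply]
  exact (inv_mul_eq_iff_eq_mul₀ hf.ne').2 (mul_comm _ _)

/-- The derivative along `N₂` vanishes by the first of the local identities. The statement uses
slices `y = const` rather than a product chart because `y` and `y'` need not lie in one chart. -/
lemma eta_dmap_fst_const [PreconnectedSpace N₂] (hι : IsPhiOrthogonal S g₁ g₂ f₁ f₂ ι)
    (hcov : IsLeviCivita g cov) (hS : IsTransSasakian S cov α β)
    (hξ : XiTangentFst 𝓘(ℝ, E₁) 𝓘(ℝ, E₂) S ι) {x₁ : N₁} {x : E₁}
    (hx : x ∈ (extChartAt 𝓘(ℝ, E₁) x₁).target) (X : E₁) (y y' : N₂) :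
    S.eta (ι ((extChartAt 𝓘(ℝ, E₁) x₁).symm x, y))
      (dmap 𝓘(ℝ, E) (fun x' => ι ((extChartAt 𝓘(ℝ, E₁) x₁).symm x', y)) x X) =
    S.eta (ι ((extChartAt 𝓘(ℝ, E₁) x₁).symm x, y'))
      (dmap 𝓘(ℝ, E) (fun x' => ι ((extChartAt 𝓘(ℝ, E₁) x₁).symm x', y')) x X) := by
  refine eq_of_hasFDerivAt_chart_zero (E₁ := E₂)
    (f := fun y => S.eta (ι ((extChartAt 𝓘(ℝ, E₁) x₁).symm x, y))
      (dmap 𝓘(ℝ, E) (fun x' => ι ((extChartAt 𝓘(ℝ, E₁) x₁).symm x', y)) x X))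
    (fun y₀ z hz => ?_) y y'
  have hq : (x, z) ∈ prodTarget E₁ E₂ x₁ y₀ := ⟨hx, hz⟩
  have hd := ((contDiffOn_eta_pullback S (isOpen_prodTarget x₁ y₀)
    (hι.contMDiffOn_comp_prodChart x₁ y₀) (X, 0)).contDiffAt
      ((isOpen_prodTarget x₁ y₀).mem_nhds hq)).differentiableAt (by simp)
  have h1 := hd.hasFDerivAt.comp z (hasFDerivAt_prodMk_right x z)
  have h2 : (fderiv ℝ (fun q => S.eta ((ι ∘ prodChart x₁ y₀) q)
      (dmap 𝓘(ℝ, E) (ι ∘ prodChart x₁ y₀) q (X, 0))) (x, z)).comp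
        (ContinuousLinearMap.inr ℝ E₁ E₂) = 0 := by
    ext Z
    exact (hι.local_identities hcov hS hξ hq).1 X Z
  refine (h1.congr_fderiv h2).congr_of_eventuallyEq ?_
  filter_upwards [(isOpen_extChartAt_target y₀).mem_nhds hz] with z' hz'
  have hq' : (x, z') ∈ prodTarget E₁ E₂ x₁ y₀ := ⟨hx, hz'⟩
  have h3 := dmap_comp_fderiv (L := fun x' : E₁ => (x', z')) (q := x) (I := 𝓘(ℝ, E))
    (ψ := ι ∘ prodChart x₁ y₀) (((hι.contMDiffOn_comp_prodChart x₁ y₀).contMDiffAt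
      ((isOpen_prodTarget x₁ y₀).mem_nhds hq')).mdifferentiableAt (by simp))
    (hasFDerivAt_prodMk_left x z').differentiableAt X
  rw [(hasFDerivAt_prodMk_left x z').fderiv] at h3
  exact congrArg (S.eta (ι ((extChartAt 𝓘(ℝ, E₁) x₁).symm x,
    (extChartAt 𝓘(ℝ, E₂) y₀).symm z'))) h3

/-- The `N₁`-component `w` of `ξ` is determined by `η(X) = f₂² g₁(X, w)`. Neither `η(X)` nor `f₂`
changes along `N₂`, so `w` does not either, and `β` is the derivative of `ln f₁` along `w`. -/
lemma beta_eq [Nontrivial E₂] [PreconnectedSpace N₂] (hι : IsPhiOrthogonal S g₁ g₂ f₁ f₂ ι)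
    (hcov : IsLeviCivita g cov) (hS : IsTransSasakian S cov α β)
    (hξ : XiTangentFst 𝓘(ℝ, E₁) 𝓘(ℝ, E₂) S ι) {x₁ : N₁} {x : E₁}
    (hx : x ∈ (extChartAt 𝓘(ℝ, E₁) x₁).target) (y y' : N₂) :
    β (ι ((extChartAt 𝓘(ℝ, E₁) x₁).symm x, y)) = β (ι ((extChartAt 𝓘(ℝ, E₁) x₁).symm x, y')) := by
  have key : ∀ y₀ : N₂, ∃ w₁ : E₁,
      mvfderiv 𝓘(ℝ, E₁) (fun x => Real.log (f₁ x)) ((extChartAt 𝓘(ℝ, E₁) x₁).symm x)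
        (dmap 𝓘(ℝ, E₁) (extChartAt 𝓘(ℝ, E₁) x₁).symm x w₁) =
          β (ι ((extChartAt 𝓘(ℝ, E₁) x₁).symm x, y₀)) ∧ ∀ X : E₁,
      S.eta (ι ((extChartAt 𝓘(ℝ, E₁) x₁).symm x, y₀))
        (dmap 𝓘(ℝ, E) (fun x' => ι ((extChartAt 𝓘(ℝ, E₁) x₁).symm x', y₀)) x X) =
        f₂ y₀ ^ 2 * g₁.inner ((extChartAt 𝓘(ℝ, E₁) x₁).symm x)
          (dmap 𝓘(ℝ, E₁) (extChartAt 𝓘(ℝ, E₁) x₁).symm x X)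
          (dmap 𝓘(ℝ, E₁) (extChartAt 𝓘(ℝ, E₁) x₁).symm x w₁) := by
    intro y₀
    obtain ⟨w, hw, hwξ⟩ := hξ ((extChartAt 𝓘(ℝ, E₁) x₁).symm x, y₀)
    obtain ⟨w₁, hw₁⟩ := exists_dmap_extChartAt_symm_eq x₁ hx
      (mfderiv (𝓘(ℝ, E₁).prod 𝓘(ℝ, E₂)) 𝓘(ℝ, E₁) (Prod.fst : N₁ × N₂ → N₁)
        ((extChartAt 𝓘(ℝ, E₁) x₁).symm x, y₀) w)
    refine ⟨w₁, ?_, fun X => ?_⟩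
    · rw [hw₁]
      exact hι.mvfderiv_log_eq hcov hS hξ hwξ
    · have hψ : MDifferentiableAt 𝓘(ℝ, E₁) (𝓘(ℝ, E₁).prod 𝓘(ℝ, E₂))
          (fun x' => ((extChartAt 𝓘(ℝ, E₁) x₁).symm x', y₀)) x :=
        (mdifferentiableAt_extChartAt_symm x₁ hx).prodMk mdifferentiableAt_const
      rw [tangentFst, LinearMap.mem_ker] at hw
      change mfderiv _ _ _ _ _ = 0 at hw
      refine (S.inner_xi _ _).symm.trans ?_
      rw [← hwξ]
      refine (congrArg (fun t => g.inner _ t _) (dmap_comp (hι.mdifferentiableAt _) hψ X)).trans ?_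
      refine (hι.isometric _ _ _).trans ?_
      rw [doublyWarpedInner, hw, map_zero, mul_zero, add_zero, hw₁]
      exact congrArg (fun t => f₂ y₀ ^ 2 * g₁.inner _ t _)
        (dmap_comp mdifferentiableAt_fst hψ X).symm
  obtain ⟨w, hw, hwX⟩ := key y
  obtain ⟨w', hw', hwX'⟩ := key y'
  have : Nonempty N₁ := ⟨x₁⟩
  suffices h : w - w' = 0 by rw [← hw, ← hw', sub_eq_zero.1 h]
  -- Test the equality of the two functionals on `X = w - w'` and use that `g₁` is definite.
  refine dmap_extChartAt_symm_injective x₁ hx (inner_self_eq_zero g₁ ?_)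
  have h := (hwX (w - w')).symm.trans
    ((hι.eta_dmap_fst_const hcov hS hξ hx (w - w') y y').trans (hwX' (w - w')))
  rw [hι.warping_snd_const hcov hS hξ y y'] at h
  have h1 := mul_left_cancel₀ (pow_pos (hι.pos_f₂ y') 2).ne' h
  rw [← sub_eq_zero, ← map_sub, ← map_sub] at h1
  exact h1

lemma exists_beta_eq [Nontrivial E₂] [ConnectedSpace N₂] (hι : IsPhiOrthogonal S g₁ g₂ f₁ f₂ ι)
    (hcov : IsLeviCivita g cov) (hS : IsTransSasakian S cov α β)
    (hξ : XiTangentFst 𝓘(ℝ, E₁) 𝓘(ℝ, E₂) S ι) :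
    ∃ β₁ : N₁ → ℝ, ContMDiff 𝓘(ℝ, E₁) 𝓘(ℝ, ℝ) ∞ β₁ ∧ ∀ p : N₁ × N₂, β (ι p) = β₁ p.1 := by
  obtain ⟨y₀⟩ := (inferInstance : Nonempty N₂)
  refine ⟨fun x => β (ι (x, y₀)), hS.smooth_beta.comp
    (hι.smooth_map.comp (contMDiff_id.prodMk contMDiff_const)), fun p => ?_⟩
  have h := hι.beta_eq hcov hS hξ (mem_extChartAt_target (I := 𝓘(ℝ, E₁)) p.1) p.2 y₀
  rwa [extChartAt_to_inv] at h

lemma mvfderiv_log_fst_eq [Nontrivial E₂] (hι : IsPhiOrthogonal S g₁ g₂ f₁ f₂ ι)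
    (hcov : IsLeviCivita g cov) (hS : IsTransSasakian S cov α β)
    (hξ : XiTangentFst 𝓘(ℝ, E₁) 𝓘(ℝ, E₂) S ι) {p : N₁ × N₂}
    {w : TangentSpace (𝓘(ℝ, E₁).prod 𝓘(ℝ, E₂)) p}
    (hw : mfderiv (𝓘(ℝ, E₁).prod 𝓘(ℝ, E₂)) 𝓘(ℝ, E) ι p w = S.xi (ι p)) :
    mvfderiv (𝓘(ℝ, E₁).prod 𝓘(ℝ, E₂)) (fun q : N₁ × N₂ => Real.log (f₁ q.1)) p w = β (ι p) := by
  rw [← hι.mvfderiv_log_eq hcov hS hξ hw]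
  have hlog : MDifferentiableAt 𝓘(ℝ, E₁) 𝓘(ℝ, ℝ) (fun x => Real.log (f₁ x)) p.1 :=
    (Real.differentiableAt_log (hι.pos_f₁ _).ne').mdifferentiableAt.comp p.1
      ((hι.smooth_f₁ _).mdifferentiableAt (by simp))
  exact DFunLike.congr_fun (mfderiv_comp p hlog mdifferentiableAt_fst) w

end IsPhiOrthogonal
end WarpedGlobal

/-! ### Exchanging the factors; `ξ` lies in one of them. -/

section Swap
open Filter Topology

variable {E E₁ E₂ : Type*} [NormedAddCommGroup E] [NormedSpace ℝ E]
  [NormedAddCommGroup E₁] [NormedSpace ℝ E₁] [NormedAddCommGroup E₂] [NormedSpace ℝ E₂]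
  {M : Type*} [TopologicalSpace M] [ChartedSpace E M] [IsManifold 𝓘(ℝ, E) ∞ M]
  {g : RiemMetric 𝓘(ℝ, E) M}
  {N₁ : Type*} [TopologicalSpace N₁] [ChartedSpace E₁ N₁]
  {N₂ : Type*} [TopologicalSpace N₂] [ChartedSpace E₂ N₂]

lemma mdifferentiableAt_swap (p : N₁ × N₂) :
    MDifferentiableAt (𝓘(ℝ, E₁).prod 𝓘(ℝ, E₂)) (𝓘(ℝ, E₂).prod 𝓘(ℝ, E₁))
      (Prod.swap : N₁ × N₂ → N₂ × N₁) p :=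
  mdifferentiableAt_snd.prodMk mdifferentiableAt_fst

lemma mfderiv_fst_mfderiv_swap (p : N₁ × N₂) (u : TangentSpace (𝓘(ℝ, E₁).prod 𝓘(ℝ, E₂)) p) :
    mfderiv (𝓘(ℝ, E₂).prod 𝓘(ℝ, E₁)) 𝓘(ℝ, E₂) (Prod.fst : N₂ × N₁ → N₂) p.swap
      (mfderiv (𝓘(ℝ, E₁).prod 𝓘(ℝ, E₂)) (𝓘(ℝ, E₂).prod 𝓘(ℝ, E₁))
        (Prod.swap : N₁ × N₂ → N₂ × N₁) p u) =
    mfderiv (𝓘(ℝ, E₁).prod 𝓘(ℝ, E₂)) 𝓘(ℝ, E₂) (Prod.snd : N₁ × N₂ → N₂) p u :=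
  (DFunLike.congr_fun (mfderiv_comp p mdifferentiableAt_fst (mdifferentiableAt_swap p)) u).symm

lemma mfderiv_snd_mfderiv_swap (p : N₁ × N₂) (u : TangentSpace (𝓘(ℝ, E₁).prod 𝓘(ℝ, E₂)) p) :
    mfderiv (𝓘(ℝ, E₂).prod 𝓘(ℝ, E₁)) 𝓘(ℝ, E₁) (Prod.snd : N₂ × N₁ → N₁) p.swap
      (mfderiv (𝓘(ℝ, E₁).prod 𝓘(ℝ, E₂)) (𝓘(ℝ, E₂).prod 𝓘(ℝ, E₁))
        (Prod.swap : N₁ × N₂ → N₂ × N₁) p u) =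
    mfderiv (𝓘(ℝ, E₁).prod 𝓘(ℝ, E₂)) 𝓘(ℝ, E₁) (Prod.fst : N₁ × N₂ → N₁) p u :=
  (DFunLike.congr_fun (mfderiv_comp p mdifferentiableAt_snd (mdifferentiableAt_swap p)) u).symm

lemma mfderiv_swap_mfderiv_swap (p : N₁ × N₂) (u : TangentSpace (𝓘(ℝ, E₁).prod 𝓘(ℝ, E₂)) p) :
    mfderiv (𝓘(ℝ, E₂).prod 𝓘(ℝ, E₁)) (𝓘(ℝ, E₁).prod 𝓘(ℝ, E₂))
      (Prod.swap : N₂ × N₁ → N₁ × N₂) p.swap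
      (mfderiv (𝓘(ℝ, E₁).prod 𝓘(ℝ, E₂)) (𝓘(ℝ, E₂).prod 𝓘(ℝ, E₁))
        (Prod.swap : N₁ × N₂ → N₂ × N₁) p u) = u :=
  tangent_prod_ext (p := p)
    ((mfderiv_fst_mfderiv_swap _ _).trans (mfderiv_snd_mfderiv_swap p u))
    ((mfderiv_snd_mfderiv_swap _ _).trans (mfderiv_fst_mfderiv_swap p u))

lemma mfderiv_swap_mem_tangentFst {p : N₁ × N₂} {u : TangentSpace (𝓘(ℝ, E₁).prod 𝓘(ℝ, E₂)) p}
    (hu : u ∈ tangentSnd 𝓘(ℝ, E₁) 𝓘(ℝ, E₂) p) :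
    mfderiv (𝓘(ℝ, E₁).prod 𝓘(ℝ, E₂)) (𝓘(ℝ, E₂).prod 𝓘(ℝ, E₁))
      (Prod.swap : N₁ × N₂ → N₂ × N₁) p u ∈ tangentFst 𝓘(ℝ, E₂) 𝓘(ℝ, E₁) p.swap := by
  rw [tangentSnd, LinearMap.mem_ker] at hu
  rw [tangentFst, LinearMap.mem_ker]
  exact (mfderiv_snd_mfderiv_swap p u).trans hu

lemma mfderiv_swap_mem_tangentSnd {p : N₁ × N₂} {u : TangentSpace (𝓘(ℝ, E₁).prod 𝓘(ℝ, E₂)) p}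
    (hu : u ∈ tangentFst 𝓘(ℝ, E₁) 𝓘(ℝ, E₂) p) :
    mfderiv (𝓘(ℝ, E₁).prod 𝓘(ℝ, E₂)) (𝓘(ℝ, E₂).prod 𝓘(ℝ, E₁))
      (Prod.swap : N₁ × N₂ → N₂ × N₁) p u ∈ tangentSnd 𝓘(ℝ, E₂) 𝓘(ℝ, E₁) p.swap := by
  rw [tangentFst, LinearMap.mem_ker] at hu
  rw [tangentSnd, LinearMap.mem_ker]
  exact (mfderiv_fst_mfderiv_swap p u).trans hu

variable [IsManifold 𝓘(ℝ, E₁) ∞ N₁] [IsManifold 𝓘(ℝ, E₂) ∞ N₂]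
  {S : AlmostContactMetric g} {g₁ : RiemMetric 𝓘(ℝ, E₁) N₁} {g₂ : RiemMetric 𝓘(ℝ, E₂) N₂}
  {f₁ : N₁ → ℝ} {f₂ : N₂ → ℝ} {ι : N₁ × N₂ → M}

lemma doublyWarpedInner_swap (p : N₂ × N₁) (u v : TangentSpace (𝓘(ℝ, E₂).prod 𝓘(ℝ, E₁)) p) :
    doublyWarpedInner g₁ g₂ f₁ f₂ p.swap
      (mfderiv (𝓘(ℝ, E₂).prod 𝓘(ℝ, E₁)) (𝓘(ℝ, E₁).prod 𝓘(ℝ, E₂))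
        (Prod.swap : N₂ × N₁ → N₁ × N₂) p u)
      (mfderiv (𝓘(ℝ, E₂).prod 𝓘(ℝ, E₁)) (𝓘(ℝ, E₁).prod 𝓘(ℝ, E₂))
        (Prod.swap : N₂ × N₁ → N₁ × N₂) p v) = doublyWarpedInner g₂ g₁ f₂ f₁ p u v := by
  rw [doublyWarpedInner, mfderiv_fst_mfderiv_swap, mfderiv_fst_mfderiv_swap,
    mfderiv_snd_mfderiv_swap, mfderiv_snd_mfderiv_swap, add_comm]
  rfl

namespace IsPhiOrthogonal

lemma mfderiv_comp_swap (hι : IsPhiOrthogonal S g₁ g₂ f₁ f₂ ι) (p : N₂ × N₁)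
    (u : TangentSpace (𝓘(ℝ, E₂).prod 𝓘(ℝ, E₁)) p) :
    mfderiv (𝓘(ℝ, E₂).prod 𝓘(ℝ, E₁)) 𝓘(ℝ, E) (ι ∘ Prod.swap) p u =
      mfderiv (𝓘(ℝ, E₁).prod 𝓘(ℝ, E₂)) 𝓘(ℝ, E) ι p.swap
        (mfderiv (𝓘(ℝ, E₂).prod 𝓘(ℝ, E₁)) (𝓘(ℝ, E₁).prod 𝓘(ℝ, E₂))
          (Prod.swap : N₂ × N₁ → N₁ × N₂) p u) :=
  DFunLike.congr_fun (mfderiv_comp p (hι.mdifferentiableAt _) (mdifferentiableAt_swap p)) u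

/-- Skew-symmetry of `φ` makes the orthogonality condition symmetric in the factors, so each result
for `ξ` tangent to the first factor has a mirror image. -/
lemma swap (hι : IsPhiOrthogonal S g₁ g₂ f₁ f₂ ι) :
    IsPhiOrthogonal S g₂ g₁ f₂ f₁ (ι ∘ Prod.swap) where
  smooth_f₁ := hι.smooth_f₂
  smooth_f₂ := hι.smooth_f₁
  pos_f₁ := hι.pos_f₂
  pos_f₂ := hι.pos_f₁
  smooth_map := hι.smooth_map.comp (contMDiff_snd.prodMk contMDiff_fst)
  isometric p u v := by
    rw [hι.mfderiv_comp_swap, hι.mfderiv_comp_swap]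
    exact (hι.isometric _ _ _).trans (doublyWarpedInner_swap p u v)
  orthogonal p u hu v hv := by
    rw [hι.mfderiv_comp_swap, hι.mfderiv_comp_swap, S.inner_phi_left, g.symm, neg_eq_zero]
    exact hι.orthogonal _ _ (mfderiv_swap_mem_tangentFst hv) _ (mfderiv_swap_mem_tangentSnd hu)

lemma xiTangentFst_swap (hι : IsPhiOrthogonal S g₁ g₂ f₁ f₂ ι)
    (hξ : XiTangentSnd 𝓘(ℝ, E₁) 𝓘(ℝ, E₂) S ι) :
    XiTangentFst 𝓘(ℝ, E₂) 𝓘(ℝ, E₁) S (ι ∘ Prod.swap) := by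
  rintro ⟨y, x⟩
  obtain ⟨w, hw, hwξ⟩ := hξ (x, y)
  refine ⟨mfderiv (𝓘(ℝ, E₁).prod 𝓘(ℝ, E₂)) (𝓘(ℝ, E₂).prod 𝓘(ℝ, E₁))
    (Prod.swap : N₁ × N₂ → N₂ × N₁) (x, y) w, mfderiv_swap_mem_tangentFst (p := (x, y)) hw, ?_⟩
  refine (hι.mfderiv_comp_swap (y, x) _).trans (Eq.trans ?_ hwξ)
  exact congrArg (mfderiv (𝓘(ℝ, E₁).prod 𝓘(ℝ, E₂)) 𝓘(ℝ, E) ι (x, y))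
    (mfderiv_swap_mfderiv_swap (x, y) w)

variable [FiniteDimensional ℝ E] [FiniteDimensional ℝ E₁] [FiniteDimensional ℝ E₂]
  {cov : CovariantDerivative 𝓘(ℝ, E) E (TangentSpace 𝓘(ℝ, E) : M → Type _)} {α β : M → ℝ}

lemma mvfderiv_log_snd_eq [Nontrivial E₁] (hι : IsPhiOrthogonal S g₁ g₂ f₁ f₂ ι)
    (hcov : IsLeviCivita g cov) (hS : IsTransSasakian S cov α β)
    (hξ : XiTangentSnd 𝓘(ℝ, E₁) 𝓘(ℝ, E₂) S ι) {p : N₁ × N₂}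
    {w : TangentSpace (𝓘(ℝ, E₁).prod 𝓘(ℝ, E₂)) p}
    (hw : mfderiv (𝓘(ℝ, E₁).prod 𝓘(ℝ, E₂)) 𝓘(ℝ, E) ι p w = S.xi (ι p)) :
    mvfderiv (𝓘(ℝ, E₁).prod 𝓘(ℝ, E₂)) (fun q : N₁ × N₂ => Real.log (f₂ q.2)) p w = β (ι p) := by
  have h := hι.swap.mvfderiv_log_fst_eq hcov hS (hι.xiTangentFst_swap hξ) (p := p.swap)
    (w := mfderiv (𝓘(ℝ, E₁).prod 𝓘(ℝ, E₂)) (𝓘(ℝ, E₂).prod 𝓘(ℝ, E₁))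
        (Prod.swap : N₁ × N₂ → N₂ × N₁) p w) (by
      refine (hι.mfderiv_comp_swap _ _).trans (Eq.trans ?_ hw)
      exact congrArg (mfderiv (𝓘(ℝ, E₁).prod 𝓘(ℝ, E₂)) 𝓘(ℝ, E) ι p)
        (mfderiv_swap_mfderiv_swap p w))
  refine Eq.trans ?_ h
  have hlog : MDifferentiableAt (𝓘(ℝ, E₂).prod 𝓘(ℝ, E₁)) 𝓘(ℝ, ℝ)
      (fun q : N₂ × N₁ => Real.log (f₂ q.1)) p.swap :=
    (Real.differentiableAt_log (hι.pos_f₂ _).ne').mdifferentiableAt.comp p.swap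
      (((hι.smooth_f₂ _).mdifferentiableAt (by simp)).comp p.swap mdifferentiableAt_fst)
  exact DFunLike.congr_fun (mfderiv_comp p hlog (mdifferentiableAt_swap p)) w

/-- After the exchange, `α g(φu, v) = 0` for all `u`, `v` tangent to `N₁`. Invariance allows `v =
φu`, and `g(φu, φu) = g(u, u)` because `η(u) = 0`. -/
lemma alpha_eq_zero [Nontrivial E₁] (hι : IsPhiOrthogonal S g₁ g₂ f₁ f₂ ι)
    (hcov : IsLeviCivita g cov) (hS : IsTransSasakian S cov α β)
    (hinv : ∀ p : N₁ × N₂, ∀ u ∈ tangentFst 𝓘(ℝ, E₁) 𝓘(ℝ, E₂) p,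
      ∃ u' ∈ tangentFst 𝓘(ℝ, E₁) 𝓘(ℝ, E₂) p,
        S.phi (ι p) (mfderiv (𝓘(ℝ, E₁).prod 𝓘(ℝ, E₂)) 𝓘(ℝ, E) ι p u) =
          mfderiv (𝓘(ℝ, E₁).prod 𝓘(ℝ, E₂)) 𝓘(ℝ, E) ι p u')
    (hξ : XiTangentSnd 𝓘(ℝ, E₁) 𝓘(ℝ, E₂) S ι) (p : N₁ × N₂) : α (ι p) = 0 := by
  have hmul : ∀ u ∈ tangentFst 𝓘(ℝ, E₁) 𝓘(ℝ, E₂) p, ∀ v ∈ tangentFst 𝓘(ℝ, E₁) 𝓘(ℝ, E₂) p,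
      α (ι p) * g.inner (ι p)
        (S.phi (ι p) (mfderiv (𝓘(ℝ, E₁).prod 𝓘(ℝ, E₂)) 𝓘(ℝ, E) ι p u))
        (mfderiv (𝓘(ℝ, E₁).prod 𝓘(ℝ, E₂)) 𝓘(ℝ, E) ι p v) = 0 := by
    intro u hu v hv
    have h := hι.swap.mul_inner_phi_eq_zero hcov hS (hι.xiTangentFst_swap hξ)
      (mfderiv_swap_mem_tangentSnd hu) (mfderiv_swap_mem_tangentSnd hv)
    rw [hι.mfderiv_comp_swap, hι.mfderiv_comp_swap, mfderiv_swap_mfderiv_swap,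
      mfderiv_swap_mfderiv_swap] at h
    exact h
  have heta : ∀ u ∈ tangentFst 𝓘(ℝ, E₁) 𝓘(ℝ, E₂) p,
      S.eta (ι p) (mfderiv (𝓘(ℝ, E₁).prod 𝓘(ℝ, E₂)) 𝓘(ℝ, E) ι p u) = 0 := by
    intro u hu
    have h := hι.swap.eta_eq_zero_of_mem_tangentSnd (hι.xiTangentFst_swap hξ)
      (mfderiv_swap_mem_tangentSnd hu)
    rw [hι.mfderiv_comp_swap, mfderiv_swap_mfderiv_swap] at h
    exact h
  obtain ⟨x₁, x₂, q, hq, rfl⟩ := exists_prodChart_eq (E₁ := E₁) (E₂ := E₂) p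
  obtain ⟨X, hX⟩ := exists_ne (0 : E₁)
  have hu := dmap_mem_tangentFst (x₁ := x₁) (x₂ := x₂) hq X
  obtain ⟨u', hu', he⟩ := hinv _ _ hu
  have h := hmul _ hu _ hu'
  rw [← he, S.inner_phi_phi, heta _ hu, mul_zero, sub_zero] at h
  refine (mul_eq_zero.1 h).resolve_right fun h0 => hX ?_
  have h1 := hι.eq_zero_of_mfderiv_eq_zero (inner_self_eq_zero g h0)
  refine dmap_extChartAt_symm_injective x₁ hq.1
    ((mfderiv_fst_dmap_prodChart hq (X, 0)).symm.trans ?_)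
  rw [h1]
  exact map_zero _

end IsPhiOrthogonal

lemma IsDoublyWarpedContactCR.isPhiOrthogonal (hι : IsDoublyWarpedContactCR S g₁ g₂ f₁ f₂ ι) :
    IsPhiOrthogonal S g₁ g₂ f₁ f₂ ι where
  smooth_f₁ := hι.smooth_f₁
  smooth_f₂ := hι.smooth_f₂
  pos_f₁ := hι.pos_f₁
  pos_f₂ := hι.pos_f₂
  smooth_map := hι.smooth_map
  isometric := hι.isometric
  orthogonal p u _ v hv := by
    rw [S.inner_phi_left, g.symm, neg_eq_zero]
    exact hι.antiInvariant p v hv u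

/-- Used for openness: if `ξ` lies in one factor at a point, then a constant coordinate vector of
that factor keeps `η ≠ 0` nearby, so `ξ` cannot lie in the other factor there. -/
lemma IsPhiOrthogonal.eventually_exists_eta_ne_zero [FiniteDimensional ℝ E]
    [FiniteDimensional ℝ E₁] [FiniteDimensional ℝ E₂]
    (hι : IsPhiOrthogonal S g₁ g₂ f₁ f₂ ι) {x₁ : N₁} {x₂ : N₂} {q : E₁ × E₂}
    (hq : q ∈ prodTarget E₁ E₂ x₁ x₂) {X : E₁ × E₂}
    (hX : S.eta (ι (prodChart x₁ x₂ q)) (mfderiv (𝓘(ℝ, E₁).prod 𝓘(ℝ, E₂)) 𝓘(ℝ, E) ι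
      (prodChart x₁ x₂ q) (dmap (𝓘(ℝ, E₁).prod 𝓘(ℝ, E₂)) (prodChart x₁ x₂) q X)) ≠ 0) :
    ∀ᶠ p in 𝓝 (prodChart x₁ x₂ q), ∃ q' ∈ prodTarget E₁ E₂ x₁ x₂, prodChart x₁ x₂ q' = p ∧
      S.eta (ι (prodChart x₁ x₂ q')) (mfderiv (𝓘(ℝ, E₁).prod 𝓘(ℝ, E₂)) 𝓘(ℝ, E) ι
        (prodChart x₁ x₂ q') (dmap (𝓘(ℝ, E₁).prod 𝓘(ℝ, E₂)) (prodChart x₁ x₂) q' X)) ≠ 0 := by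
  have hc := ((contDiffOn_eta_pullback S (isOpen_prodTarget x₁ x₂)
    (hι.contMDiffOn_comp_prodChart x₁ x₂) X).contDiffAt
      ((isOpen_prodTarget x₁ x₂).mem_nhds hq)).continuousAt
  have hne := (hc.eventually_ne (by rw [hι.dmap_comp_prodChart hq]; exact hX)).and
    ((isOpen_prodTarget x₁ x₂).mem_nhds hq)
  have hs₁ : (prodChart x₁ x₂ q).1 ∈ (extChartAt 𝓘(ℝ, E₁) x₁).source :=
    (extChartAt 𝓘(ℝ, E₁) x₁).map_target hq.1
  have hs₂ : (prodChart x₁ x₂ q).2 ∈ (extChartAt 𝓘(ℝ, E₂) x₂).source :=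
    (extChartAt 𝓘(ℝ, E₂) x₂).map_target hq.2
  have ht : Tendsto (fun p : N₁ × N₂ => (extChartAt 𝓘(ℝ, E₁) x₁ p.1, extChartAt 𝓘(ℝ, E₂) x₂ p.2))
      (𝓝 (prodChart x₁ x₂ q)) (𝓝 q) := by
    have h : ContinuousAt
        (fun p : N₁ × N₂ => (extChartAt 𝓘(ℝ, E₁) x₁ p.1, extChartAt 𝓘(ℝ, E₂) x₂ p.2))
        (prodChart x₁ x₂ q) :=
      ((continuousAt_extChartAt' hs₁).comp continuousAt_fst).prodMk
        ((continuousAt_extChartAt' hs₂).comp continuousAt_snd)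
    have he : (extChartAt 𝓘(ℝ, E₁) x₁ (prodChart x₁ x₂ q).1,
        extChartAt 𝓘(ℝ, E₂) x₂ (prodChart x₁ x₂ q).2) = q :=
      Prod.ext ((extChartAt 𝓘(ℝ, E₁) x₁).right_inv hq.1)
        ((extChartAt 𝓘(ℝ, E₂) x₂).right_inv hq.2)
    have h' := h.tendsto
    rwa [he] at h'
  have hsrc : ∀ᶠ p : N₁ × N₂ in 𝓝 (prodChart x₁ x₂ q),
      p ∈ (extChartAt 𝓘(ℝ, E₁) x₁).source ×ˢ (extChartAt 𝓘(ℝ, E₂) x₂).source :=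
    ((isOpen_extChartAt_source x₁).prod (isOpen_extChartAt_source x₂)).mem_nhds ⟨hs₁, hs₂⟩
  filter_upwards [ht.eventually hne, hsrc] with p hp hps
  refine ⟨_, hp.2, Prod.ext ((extChartAt 𝓘(ℝ, E₁) x₁).left_inv hps.1)
    ((extChartAt 𝓘(ℝ, E₂) x₂).left_inv hps.2), ?_⟩
  have h := hp.1
  rw [hι.dmap_comp_prodChart hp.2] at h
  exact h

lemma doublyWarpedInner_eq_zero {p : N₁ × N₂}
    {u v : TangentSpace (𝓘(ℝ, E₁).prod 𝓘(ℝ, E₂)) p}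
    (hu : u ∈ tangentFst 𝓘(ℝ, E₁) 𝓘(ℝ, E₂) p) (hv : v ∈ tangentSnd 𝓘(ℝ, E₁) 𝓘(ℝ, E₂) p) :
    doublyWarpedInner g₁ g₂ f₁ f₂ p u v = 0 := by
  rw [tangentFst, LinearMap.mem_ker] at hu
  rw [tangentSnd, LinearMap.mem_ker] at hv
  change mfderiv _ _ _ _ _ = 0 at hu hv
  rw [doublyWarpedInner, hu, hv]
  simp only [map_zero, zero_apply, mul_zero, add_zero]

namespace IsDoublyWarpedContactCR

lemma mem_tangentFst_or_mem_tangentSnd (hι : IsDoublyWarpedContactCR S g₁ g₂ f₁ f₂ ι)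
    {p : N₁ × N₂} {w : TangentSpace (𝓘(ℝ, E₁).prod 𝓘(ℝ, E₂)) p}
    (hw : mfderiv (𝓘(ℝ, E₁).prod 𝓘(ℝ, E₂)) 𝓘(ℝ, E) ι p w = S.xi (ι p)) :
    w ∈ tangentFst 𝓘(ℝ, E₁) 𝓘(ℝ, E₂) p ∨ w ∈ tangentSnd 𝓘(ℝ, E₁) 𝓘(ℝ, E₂) p := by
  by_cases h : ∃ u ∈ tangentFst 𝓘(ℝ, E₁) 𝓘(ℝ, E₂) p,
    S.eta (ι p) (mfderiv (𝓘(ℝ, E₁).prod 𝓘(ℝ, E₂)) 𝓘(ℝ, E) ι p u) ≠ 0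
  · left
    obtain ⟨u, hu, hne⟩ := h
    obtain ⟨u', hu', h1⟩ := hι.invariant p u hu
    obtain ⟨u'', hu'', h2⟩ := hι.invariant p u' hu'
    have h3 := S.phi_phi (ι p) (mfderiv (𝓘(ℝ, E₁).prod 𝓘(ℝ, E₂)) 𝓘(ℝ, E) ι p u)
    rw [h1, h2] at h3
    -- Since `u''` represents `φ²u = -u + η(u) ξ`, a nonzero multiple of `ξ` lies in the invariant
    -- distribution.
    have h4 : u + u'' = S.eta (ι p) (mfderiv (𝓘(ℝ, E₁).prod 𝓘(ℝ, E₂)) 𝓘(ℝ, E) ι p u) • w := by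
      refine hι.isPhiOrthogonal.eq_of_mfderiv_eq ?_
      rw [map_add, map_smul, hw, h3, add_neg_cancel_left]
    rw [← Submodule.smul_mem_iff _ hne, ← h4]
    exact add_mem hu hu''
  · right
    push Not at h
    obtain ⟨x₁, x₂, q, hq, rfl⟩ := exists_prodChart_eq (E₁ := E₁) (E₂ := E₂) p
    obtain ⟨⟨w₁, w₂⟩, rfl⟩ := exists_dmap_prodChart_eq hq w
    -- Here `ξ` is orthogonal to the first factor. Pairing it with its own component `(w₁, 0)` gives
    -- `f₂² g₁(w₁, w₁) = 0`.
    have h1 := h _ (IsPhiOrthogonal.dmap_mem_tangentFst hq w₁)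
    rw [← S.inner_xi, ← hw] at h1
    have h2 := (hι.isometric _ _ _).symm.trans h1
    have hu := IsPhiOrthogonal.dmap_mem_tangentFst hq w₁
    rw [tangentFst, LinearMap.mem_ker] at hu
    change mfderiv _ _ _ _ _ = 0 at hu
    rw [doublyWarpedInner, hu, (mfderiv_fst_dmap_prodChart hq (w₁, 0)).trans
      (mfderiv_fst_dmap_prodChart hq (w₁, w₂)).symm] at h2
    simp only [map_zero, zero_apply, mul_zero, add_zero] at h2
    rw [tangentSnd, LinearMap.mem_ker]
    exact inner_self_eq_zero g₁ ((mul_eq_zero.1 h2).resolve_left (pow_pos (hι.pos_f₂ _) 2).ne')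

variable [FiniteDimensional ℝ E] [FiniteDimensional ℝ E₁] [FiniteDimensional ℝ E₂]

theorem xiTangentFst_or_xiTangentSnd [PreconnectedSpace N₁] [PreconnectedSpace N₂]
    (hι : IsDoublyWarpedContactCR S g₁ g₂ f₁ f₂ ι) :
    XiTangentFst 𝓘(ℝ, E₁) 𝓘(ℝ, E₂) S ι ∨ XiTangentSnd 𝓘(ℝ, E₁) 𝓘(ℝ, E₂) S ι := by
  have hdisj : ∀ p : N₁ × N₂, ∀ u ∈ tangentFst 𝓘(ℝ, E₁) 𝓘(ℝ, E₂) p,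
      ∀ v ∈ tangentSnd 𝓘(ℝ, E₁) 𝓘(ℝ, E₂) p, g.inner (ι p)
        (mfderiv (𝓘(ℝ, E₁).prod 𝓘(ℝ, E₂)) 𝓘(ℝ, E) ι p u)
        (mfderiv (𝓘(ℝ, E₁).prod 𝓘(ℝ, E₂)) 𝓘(ℝ, E) ι p v) = 0 :=
    fun p u hu v hv => (hι.isometric p u v).trans (doublyWarpedInner_eq_zero hu hv)
  -- The two alternatives are exhaustive, and exclusive because `ξ` would otherwise be orthogonal to
  -- itself. Each is open, so on the connected product one of them is everything.
  have hcompl : {p | ∃ w ∈ tangentFst 𝓘(ℝ, E₁) 𝓘(ℝ, E₂) p,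
        mfderiv (𝓘(ℝ, E₁).prod 𝓘(ℝ, E₂)) 𝓘(ℝ, E) ι p w = S.xi (ι p)}ᶜ =
      {p | ∃ w ∈ tangentSnd 𝓘(ℝ, E₁) 𝓘(ℝ, E₂) p,
        mfderiv (𝓘(ℝ, E₁).prod 𝓘(ℝ, E₂)) 𝓘(ℝ, E) ι p w = S.xi (ι p)} := by
    ext p
    constructor
    · intro hp
      obtain ⟨w, hw⟩ := hι.xi_tangent p
      exact ⟨w, (hι.mem_tangentFst_or_mem_tangentSnd hw).resolve_left fun h => hp ⟨w, h, hw⟩, hw⟩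
    · rintro ⟨w, hw, hwξ⟩ ⟨u, hu, huξ⟩
      have h := hdisj p u hu w hw
      rw [huξ, hwξ, S.inner_xi, S.eta_xi] at h
      exact one_ne_zero h
  have hclopen : IsClopen {p | ∃ w ∈ tangentFst 𝓘(ℝ, E₁) 𝓘(ℝ, E₂) p,
        mfderiv (𝓘(ℝ, E₁).prod 𝓘(ℝ, E₂)) 𝓘(ℝ, E) ι p w = S.xi (ι p)} := by
    refine ⟨⟨?_⟩, ?_⟩
    · rw [hcompl, isOpen_iff_mem_nhds]
      rintro p ⟨w, hw, hwξ⟩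
      rw [← hcompl]
      obtain ⟨x₁, x₂, q, hq, rfl⟩ := exists_prodChart_eq (E₁ := E₁) (E₂ := E₂) p
      obtain ⟨⟨w₁, w₂⟩, rfl⟩ := exists_dmap_prodChart_eq hq w
      rw [tangentSnd, LinearMap.mem_ker] at hw
      obtain rfl : w₁ = 0 := dmap_extChartAt_symm_injective x₁ hq.1
        ((mfderiv_fst_dmap_prodChart hq _).symm.trans hw)
      filter_upwards [hι.isPhiOrthogonal.eventually_exists_eta_ne_zero hq
        (X := (0, w₂)) (by rw [hwξ, S.eta_xi]; exact one_ne_zero)]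
      rintro _ ⟨q', hq', rfl, hne⟩ ⟨u, hu, huξ⟩
      refine hne ?_
      rw [← S.inner_xi, ← huξ, g.symm]
      exact hdisj _ _ hu _ (IsPhiOrthogonal.dmap_mem_tangentSnd hq' w₂)
    · rw [isOpen_iff_mem_nhds]
      rintro p ⟨w, hw, hwξ⟩
      rw [← compl_compl {p | _}, hcompl]
      obtain ⟨x₁, x₂, q, hq, rfl⟩ := exists_prodChart_eq (E₁ := E₁) (E₂ := E₂) p
      obtain ⟨⟨w₁, w₂⟩, rfl⟩ := exists_dmap_prodChart_eq hq w
      rw [tangentFst, LinearMap.mem_ker] at hw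
      obtain rfl : w₂ = 0 := dmap_extChartAt_symm_injective x₂ hq.2
        ((mfderiv_snd_dmap_prodChart hq _).symm.trans hw)
      filter_upwards [hι.isPhiOrthogonal.eventually_exists_eta_ne_zero hq
        (X := (w₁, 0)) (by rw [hwξ, S.eta_xi]; exact one_ne_zero)]
      rintro _ ⟨q', hq', rfl, hne⟩ ⟨u, hu, huξ⟩
      refine hne ?_
      rw [← S.inner_xi, ← huξ]
      exact hdisj _ _ (IsPhiOrthogonal.dmap_mem_tangentFst hq' w₁) _ hu
  rcases isClopen_iff.1 hclopen with h | h
  · right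
    intro p
    have : p ∈ {p | ∃ w ∈ tangentFst 𝓘(ℝ, E₁) 𝓘(ℝ, E₂) p,
        mfderiv (𝓘(ℝ, E₁).prod 𝓘(ℝ, E₂)) 𝓘(ℝ, E) ι p w = S.xi (ι p)}ᶜ := by
      rw [h]; exact Set.notMem_empty p
    rw [hcompl] at this
    exact this
  · left
    intro p
    have : p ∈ {p | ∃ w ∈ tangentFst 𝓘(ℝ, E₁) 𝓘(ℝ, E₂) p,
        mfderiv (𝓘(ℝ, E₁).prod 𝓘(ℝ, E₂)) 𝓘(ℝ, E) ι p w = S.xi (ι p)} := by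
      rw [h]; exact Set.mem_univ p
    exact this

end IsDoublyWarpedContactCR
end Swap

/-! ### From `dα ∧ Φ = -α dΦ` to unique continuation of `α = 0`. -/

section Analysis
open Filter Topology

variable {E : Type*} [NormedAddCommGroup E] [NormedSpace ℝ E]

/-- This is `d(dθ) = 0` for `dθ = -2 a Ψ`, evaluated on constant vectors: differentiate, sum
cyclically, and cancel the second derivatives of `θ` by symmetry. -/
lemma fderiv_cyclic_sum_eq {W : Set E} (hW : IsOpen W) {θ : E → E → ℝ} {a : E → ℝ}
    {Ψ : E → E → E → ℝ} (hθ : ∀ Y, ContDiffOn ℝ ∞ (θ Y) W) (ha : ∀ q ∈ W, DifferentiableAt ℝ a q)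
    (hΨ : ∀ X Y, ∀ q ∈ W, DifferentiableAt ℝ (Ψ X Y) q)
    (h : ∀ X Y, ∀ q ∈ W, fderiv ℝ (θ Y) q X - fderiv ℝ (θ X) q Y = -2 * (a q * Ψ X Y q))
    {q : E} (hq : q ∈ W) (X Y Z : E) :
    fderiv ℝ a q Z * Ψ X Y q + fderiv ℝ a q X * Ψ Y Z q + fderiv ℝ a q Y * Ψ Z X q =
      -(a q * (fderiv ℝ (Ψ X Y) q Z + fderiv ℝ (Ψ Y Z) q X + fderiv ℝ (Ψ Z X) q Y)) := by
  have hd : ∀ Y, DifferentiableAt ℝ (fderiv ℝ (θ Y)) q := fun Y =>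
    (((hθ Y).contDiffAt (hW.mem_nhds hq)).fderiv_right (m := 1)
      (by rw [one_add_one_eq_two]; exact ENat.LEInfty.out)).differentiableAt
      (by simp)
  have hsymm : ∀ X Y Z, fderiv ℝ (fderiv ℝ (θ Y)) q X Z = fderiv ℝ (fderiv ℝ (θ Y)) q Z X :=
    fun X Y Z => (((hθ Y).contDiffAt (hW.mem_nhds hq)).isSymmSndFDerivAt
      (by rw [minSmoothness_of_isRCLikeNormedField]; exact ENat.LEInfty.out)).eq X Z
  have key : ∀ X Y Z, fderiv ℝ (fderiv ℝ (θ Y)) q Z X - fderiv ℝ (fderiv ℝ (θ X)) q Z Y =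
      -2 * (a q * fderiv ℝ (Ψ X Y) q Z + fderiv ℝ a q Z * Ψ X Y q) := by
    intro X Y Z
    have h1 : HasFDerivAt (fun q => fderiv ℝ (θ Y) q X - fderiv ℝ (θ X) q Y) _ q :=
      ((hd Y).hasFDerivAt.clm_apply (hasFDerivAt_const X q)).sub
        ((hd X).hasFDerivAt.clm_apply (hasFDerivAt_const Y q))
    have h2 : HasFDerivAt (fun q => -2 * (a q * Ψ X Y q)) _ q :=
      ((ha q hq).hasFDerivAt.mul (hΨ X Y q hq).hasFDerivAt).const_mul (-2)
    have h3 : (fun q => fderiv ℝ (θ Y) q X - fderiv ℝ (θ X) q Y) =ᶠ[𝓝 q]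
        fun q => -2 * (a q * Ψ X Y q) := by
      filter_upwards [hW.mem_nhds hq] with q' hq' using h X Y q' hq'
    have h4 := DFunLike.congr_fun (h1.unique (h2.congr_of_eventuallyEq h3)) Z
    simpa [mul_comm, mul_add, neg_add] using h4
  linear_combination (1 / 2) * (key X Y Z + key Y Z X + key Z X Y) -
    (1 / 2) * (hsymm Z Y X + hsymm X Z Y + hsymm Y X Z)

/-- Injectivity of `l ↦ l ∧ Ψ` at `q₀`, with compactness of the dual unit sphere, gives a uniform
lower bound near `q₀`, which is applied to the normalised differential of `a`. -/
lemma exists_norm_fderiv_le [FiniteDimensional ℝ E] {a : E → ℝ} {q₀ : E} {Ψ : E → E → E → ℝ}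
    {R : E → E → E → E → ℝ} (hΨ : ∀ X Y, ContinuousAt (Ψ X Y) q₀)
    (hR : ∀ X Y Z, ContinuousAt (R X Y Z) q₀)
    (h : ∀ᶠ q in 𝓝 q₀, ∀ X Y Z,
      fderiv ℝ a q Z * Ψ X Y q + fderiv ℝ a q X * Ψ Y Z q + fderiv ℝ a q Y * Ψ Z X q =
        -(a q * R X Y Z q))
    (hne : ∀ l : E →L[ℝ] ℝ,
      (∀ X Y Z, l Z * Ψ X Y q₀ + l X * Ψ Y Z q₀ + l Y * Ψ Z X q₀ = 0) → l = 0) :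
    ∃ C : ℝ, ∀ᶠ q in 𝓝 q₀, ‖fderiv ℝ a q‖ ≤ C * ‖a q‖ := by
  -- The vectors may depend on `l`. The bound compares `R` with the wedge on the same triple, and
  -- strict positivity is recorded so that `|R|` can be cancelled at the end.
  obtain ⟨C, hC⟩ : ∃ C : ℝ, ∀ᶠ q in 𝓝 q₀, ∀ l ∈ Metric.sphere (0 : E →L[ℝ] ℝ) 1, ∃ X Y Z,
      |R X Y Z q| ≤ C * |l Z * Ψ X Y q + l X * Ψ Y Z q + l Y * Ψ Z X q| ∧
        0 < |l Z * Ψ X Y q + l X * Ψ Y Z q + l Y * Ψ Z X q| := by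
    refine (isCompact_sphere (0 : E →L[ℝ] ℝ) 1).induction_on
      (p := fun s => ∃ C : ℝ, ∀ᶠ q in 𝓝 q₀, ∀ l ∈ s, ∃ X Y Z,
        |R X Y Z q| ≤ C * |l Z * Ψ X Y q + l X * Ψ Y Z q + l Y * Ψ Z X q| ∧
          0 < |l Z * Ψ X Y q + l X * Ψ Y Z q + l Y * Ψ Z X q|) ?_ ?_ ?_ ?_
    · exact ⟨0, Eventually.of_forall fun q l hl => (Set.notMem_empty l hl).elim⟩
    · rintro s t hst ⟨C, hC⟩
      exact ⟨C, hC.mono fun q hq l hl => hq l (hst hl)⟩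
    · rintro s t ⟨C, hC⟩ ⟨C', hC'⟩
      refine ⟨max C C', ?_⟩
      filter_upwards [hC, hC'] with q hq hq' l hl
      rcases hl with hl | hl
      · obtain ⟨X, Y, Z, h1, h2⟩ := hq l hl
        exact ⟨X, Y, Z, h1.trans (by gcongr; exact le_max_left _ _), h2⟩
      · obtain ⟨X, Y, Z, h1, h2⟩ := hq' l hl
        exact ⟨X, Y, Z, h1.trans (by gcongr; exact le_max_right _ _), h2⟩
    · intro l hl
      obtain ⟨X, Y, Z, hXYZ⟩ : ∃ X Y Z, l Z * Ψ X Y q₀ + l X * Ψ Y Z q₀ + l Y * Ψ Z X q₀ ≠ 0 := by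
        by_contra! hcon
        rw [hne l hcon] at hl
        simp at hl
      have hcont : ContinuousAt (fun z : E × (E →L[ℝ] ℝ) =>
          |z.2 Z * Ψ X Y z.1 + z.2 X * Ψ Y Z z.1 + z.2 Y * Ψ Z X z.1|) (q₀, l) := by
        have hfst : ∀ f : E → ℝ, ContinuousAt f q₀ →
            ContinuousAt (fun z : E × (E →L[ℝ] ℝ) => f z.1) (q₀, l) := fun f hf =>
          ContinuousAt.comp (f := Prod.fst) hf continuousAt_fst
        have hev : ∀ Z : E, ContinuousAt (fun z : E × (E →L[ℝ] ℝ) => z.2 Z) (q₀, l) := fun Z =>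
          (continuous_snd.clm_apply continuous_const).continuousAt
        exact ((((hev Z).mul (hfst _ (hΨ X Y))).add ((hev X).mul (hfst _ (hΨ Y Z)))).add
          ((hev Y).mul (hfst _ (hΨ Z X)))).abs
      -- By continuity the wedge stays above `d / 2` and `|R|` below its value at `q₀` plus one,
      -- which gives the constant of this neighbourhood of `l`.
      set d := |l Z * Ψ X Y q₀ + l X * Ψ Y Z q₀ + l Y * Ψ Z X q₀| with hd
      have hdpos : 0 < d := abs_pos.2 hXYZ
      have h1 := hcont.eventually (lt_mem_nhds (show d / 2 < _ from half_lt_self hdpos))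
      rw [nhds_prod_eq] at h1
      obtain ⟨pa, hpa, pb, hpb, hab⟩ := eventually_prod_iff.1 h1
      refine ⟨{l' | pb l'}, mem_nhdsWithin_of_mem_nhds hpb,
        (|R X Y Z q₀| + 1) / (d / 2), ?_⟩
      have h2 := (hR X Y Z).abs.eventually (gt_mem_nhds (lt_add_one _))
      filter_upwards [hpa, h2] with q hq hq2 l' hl'
      have h3 := hab hq hl'
      refine ⟨X, Y, Z, ?_, (half_pos hdpos).trans h3⟩
      refine hq2.le.trans ?_
      rw [div_mul_eq_mul_div, le_div_iff₀ (half_pos hdpos)]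
      exact mul_le_mul_of_nonneg_left h3.le (by positivity)
  -- `C` may be negative; the maximum covers the points where the differential vanishes.
  refine ⟨max C 0, ?_⟩
  filter_upwards [h, hC] with q hq hCq
  by_cases h0 : fderiv ℝ a q = 0
  · rw [h0, norm_zero]
    exact mul_nonneg (le_max_right _ _) (norm_nonneg _)
  · refine le_trans ?_ (mul_le_mul_of_nonneg_right (le_max_left C 0) (norm_nonneg _))
    have hn : 0 < ‖fderiv ℝ a q‖ := norm_pos_iff.2 h0
    obtain ⟨X, Y, Z, h1, h2⟩ := hCq (‖fderiv ℝ a q‖⁻¹ • fderiv ℝ a q) (by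
      rw [mem_sphere_zero_iff_norm, norm_smul, norm_inv, norm_norm, inv_mul_cancel₀ hn.ne'])
    have h3 := hq X Y Z
    have h4 : (‖fderiv ℝ a q‖⁻¹ • fderiv ℝ a q) Z * Ψ X Y q +
        (‖fderiv ℝ a q‖⁻¹ • fderiv ℝ a q) X * Ψ Y Z q +
        (‖fderiv ℝ a q‖⁻¹ • fderiv ℝ a q) Y * Ψ Z X q =
        ‖fderiv ℝ a q‖⁻¹ * -(a q * R X Y Z q) := by
      rw [← h3]
      simp only [smul_apply, smul_eq_mul]
      ring
    rw [h4] at h1 h2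
    rw [abs_mul, abs_neg, abs_mul, abs_of_pos (inv_pos.2 hn)] at h1 h2
    have hRpos : 0 < |R X Y Z q| := by
      by_contra hcon
      rw [le_antisymm (not_lt.1 hcon) (abs_nonneg _)] at h2
      simp at h2
    rw [Real.norm_eq_abs (a q)]
    refine le_of_mul_le_mul_right ?_ (mul_pos (inv_pos.2 hn) hRpos)
    calc ‖fderiv ℝ a q‖ * (‖fderiv ℝ a q‖⁻¹ * |R X Y Z q|) = |R X Y Z q| := by
          rw [mul_inv_cancel_left₀ hn.ne']
      _ ≤ _ := h1
      _ = _ := by ring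

/-- Grönwall along the segment from `q₀` to `q`, where the derivative is bounded by `C ‖q - q₀‖`
times the function. -/
lemma eventually_eq_zero_of_norm_fderiv_le {a : E → ℝ} {q₀ : E} {C : ℝ}
    (ha : ∀ᶠ q in 𝓝 q₀, DifferentiableAt ℝ a q)
    (h : ∀ᶠ q in 𝓝 q₀, ‖fderiv ℝ a q‖ ≤ C * ‖a q‖) (h0 : a q₀ = 0) :
    ∀ᶠ q in 𝓝 q₀, a q = 0 := by
  obtain ⟨r, hr, hball⟩ := Metric.eventually_nhds_iff_ball.1 (ha.and h)
  filter_upwards [Metric.ball_mem_nhds q₀ hr] with q hq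
  have hmem : ∀ t ∈ Set.Icc (0 : ℝ) 1, AffineMap.lineMap q₀ q t ∈ Metric.ball q₀ r := fun t ht =>
    (convex_ball q₀ r).lineMap_mem (Metric.mem_ball_self hr) hq ht
  have hder : ∀ t ∈ Set.Icc (0 : ℝ) 1, HasDerivAt (fun t => a (AffineMap.lineMap q₀ q t))
      (fderiv ℝ a (AffineMap.lineMap q₀ q t) (q - q₀)) t := fun t ht =>
    (hball _ (hmem t ht)).1.hasFDerivAt.comp_hasDerivAt t AffineMap.hasDerivAt_lineMap
  have h1 := eq_zero_of_abs_deriv_le_mul_abs_self_of_eq_zero_right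
    (f := fun t : ℝ => a (AffineMap.lineMap q₀ q t)) (K := C * ‖q - q₀‖) (a := 0) (b := 1)
    (fun t ht => (hder t ht).continuousAt.continuousWithinAt)
    (fun t ht => (hder t ⟨ht.1, ht.2.le⟩).hasDerivWithinAt) (by simpa using h0)
    (fun t ht => by
      refine (ContinuousLinearMap.le_opNorm _ _).trans ?_
      have := (hball _ (hmem t ⟨ht.1, ht.2.le⟩)).2
      calc _ ≤ (C * ‖a (AffineMap.lineMap q₀ q t)‖) * ‖q - q₀‖ := by gcongr
        _ = _ := by ring) 1 ⟨zero_le_one, le_rfl⟩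
  simpa using h1

end Analysis

/-! ### Vanishing of `α` on a connected ambient manifold. -/

section Ambient
open Filter Topology

variable {E : Type*} [NormedAddCommGroup E] [NormedSpace ℝ E] [FiniteDimensional ℝ E]
  {M : Type*} [TopologicalSpace M] [ChartedSpace E M] [IsManifold 𝓘(ℝ, E) ∞ M]
  {g : RiemMetric 𝓘(ℝ, E) M} {S : AlmostContactMetric g}
  {cov : CovariantDerivative 𝓘(ℝ, E) E (TangentSpace 𝓘(ℝ, E) : M → Type _)} {α β : M → ℝ}

/-- Three linear conditions on a space of dimension at least four; this is where the dimension
hypothesis enters. -/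
lemma exists_orthogonal_ne_zero (S : AlmostContactMetric g) (h4 : 4 ≤ Module.finrank ℝ E)
    (x₀ : M) (q Z : E) :
    ∃ X : E, X ≠ 0 ∧
      g.inner ((extChartAt 𝓘(ℝ, E) x₀).symm q)
        (dmap 𝓘(ℝ, E) (extChartAt 𝓘(ℝ, E) x₀).symm q Z)
        (dmap 𝓘(ℝ, E) (extChartAt 𝓘(ℝ, E) x₀).symm q X) = 0 ∧
      g.inner ((extChartAt 𝓘(ℝ, E) x₀).symm q)
        (S.phi _ (dmap 𝓘(ℝ, E) (extChartAt 𝓘(ℝ, E) x₀).symm q Z))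
        (dmap 𝓘(ℝ, E) (extChartAt 𝓘(ℝ, E) x₀).symm q X) = 0 ∧
      S.eta _ (dmap 𝓘(ℝ, E) (extChartAt 𝓘(ℝ, E) x₀).symm q X) = 0 := by
  let A : E →ₗ[ℝ] ℝ × ℝ × ℝ :=
    ((g.inner ((extChartAt 𝓘(ℝ, E) x₀).symm q)
      (dmap 𝓘(ℝ, E) (extChartAt 𝓘(ℝ, E) x₀).symm q Z)).toLinearMap ∘ₗ
        (dmap 𝓘(ℝ, E) (extChartAt 𝓘(ℝ, E) x₀).symm q).toLinearMap).prod
    (((g.inner ((extChartAt 𝓘(ℝ, E) x₀).symm q)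
      (S.phi _ (dmap 𝓘(ℝ, E) (extChartAt 𝓘(ℝ, E) x₀).symm q Z))).toLinearMap ∘ₗ
        (dmap 𝓘(ℝ, E) (extChartAt 𝓘(ℝ, E) x₀).symm q).toLinearMap).prod
    ((S.eta ((extChartAt 𝓘(ℝ, E) x₀).symm q)).toLinearMap ∘ₗ
        (dmap 𝓘(ℝ, E) (extChartAt 𝓘(ℝ, E) x₀).symm q).toLinearMap))
  have hA : LinearMap.ker A ≠ ⊥ := LinearMap.ker_ne_bot_of_finrank_lt (by
    simp only [Module.finrank_prod, Module.finrank_self]; omega)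
  obtain ⟨X, hX, hX0⟩ := (Submodule.ne_bot_iff _).1 hA
  rw [LinearMap.mem_ker] at hX
  exact ⟨X, hX0, congrArg Prod.fst hX, congrArg (fun t => t.2.1) hX, congrArg (fun t => t.2.2) hX⟩

/-- Take `X` orthogonal to `Z`, `φZ` and `ξ`, and `Y = φX`. Then `(l ∧ Φ)(X, Y, Z)` reduces to `l(Z)
g(X, X)`, which proves that wedging with `Φ` is injective. -/
lemma exists_phi_pairing (S : AlmostContactMetric g) (h4 : 4 ≤ Module.finrank ℝ E) {x₀ : M}
    {q : E} (hq : q ∈ (extChartAt 𝓘(ℝ, E) x₀).target) (Z : E) :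
    ∃ X Y : E,
      g.inner ((extChartAt 𝓘(ℝ, E) x₀).symm q)
        (S.phi _ (dmap 𝓘(ℝ, E) (extChartAt 𝓘(ℝ, E) x₀).symm q X))
        (dmap 𝓘(ℝ, E) (extChartAt 𝓘(ℝ, E) x₀).symm q Y) ≠ 0 ∧
      g.inner ((extChartAt 𝓘(ℝ, E) x₀).symm q)
        (S.phi _ (dmap 𝓘(ℝ, E) (extChartAt 𝓘(ℝ, E) x₀).symm q Y))
        (dmap 𝓘(ℝ, E) (extChartAt 𝓘(ℝ, E) x₀).symm q Z) = 0 ∧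
      g.inner ((extChartAt 𝓘(ℝ, E) x₀).symm q)
        (S.phi _ (dmap 𝓘(ℝ, E) (extChartAt 𝓘(ℝ, E) x₀).symm q Z))
        (dmap 𝓘(ℝ, E) (extChartAt 𝓘(ℝ, E) x₀).symm q X) = 0 := by
  obtain ⟨X, hX, h1, h2, h3⟩ := exists_orthogonal_ne_zero S h4 x₀ q Z
  obtain ⟨Y, hY⟩ := exists_dmap_extChartAt_symm_eq x₀ hq
    (S.phi _ (dmap 𝓘(ℝ, E) (extChartAt 𝓘(ℝ, E) x₀).symm q X))
  refine ⟨X, Y, ?_, ?_, h2⟩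
  · rw [hY, S.inner_phi_phi, h3, mul_zero, sub_zero]
    exact fun h => hX (dmap_extChartAt_symm_injective x₀ hq (inner_self_eq_zero g h))
  · rw [hY, S.phi_phi, h3, zero_smul, add_zero, map_neg, neg_apply, g.symm, h1, neg_zero]

lemma eventually_alpha_eq_zero (hcov : IsLeviCivita g cov) (hS : IsTransSasakian S cov α β)
    (h4 : 4 ≤ Module.finrank ℝ E) {x₀ : M} (h0 : α x₀ = 0) : ∀ᶠ x in 𝓝 x₀, α x = 0 := by
  have hW := isOpen_extChartAt_target (I := 𝓘(ℝ, E)) x₀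
  have hκ := contMDiffOn_extChartAt_symm (I := 𝓘(ℝ, E)) (n := ∞) x₀
  have hq₀ := mem_extChartAt_target (I := 𝓘(ℝ, E)) x₀
  have ha : ContDiffOn ℝ ∞ (α ∘ (extChartAt 𝓘(ℝ, E) x₀).symm) (extChartAt 𝓘(ℝ, E) x₀).target :=
    contDiffOn_comp_extChartAt_symm fun q _ => hS.smooth_alpha q
  have hθ := contDiffOn_eta_pullback S hW hκ
  have hΨ := contDiffOn_metric_phi_pullback S hW hκ
  have hdiff : ∀ {f : E → ℝ}, ContDiffOn ℝ ∞ f (extChartAt 𝓘(ℝ, E) x₀).target →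
      ∀ q ∈ (extChartAt 𝓘(ℝ, E) x₀).target, DifferentiableAt ℝ f q := fun hf q hq =>
    (hf.contDiffAt (hW.mem_nhds hq)).differentiableAt (by simp)
  have hext : ∀ X Y : E, ∀ q ∈ (extChartAt 𝓘(ℝ, E) x₀).target,
      fderiv ℝ (fun q => S.eta ((extChartAt 𝓘(ℝ, E) x₀).symm q)
        (dmap 𝓘(ℝ, E) (extChartAt 𝓘(ℝ, E) x₀).symm q Y)) q X -
      fderiv ℝ (fun q => S.eta ((extChartAt 𝓘(ℝ, E) x₀).symm q)
        (dmap 𝓘(ℝ, E) (extChartAt 𝓘(ℝ, E) x₀).symm q X)) q Y =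
      -2 * ((α ∘ (extChartAt 𝓘(ℝ, E) x₀).symm) q * g.inner ((extChartAt 𝓘(ℝ, E) x₀).symm q)
        (S.phi _ (dmap 𝓘(ℝ, E) (extChartAt 𝓘(ℝ, E) x₀).symm q X))
        (dmap 𝓘(ℝ, E) (extChartAt 𝓘(ℝ, E) x₀).symm q Y)) := by
    intro X Y q hq
    obtain ⟨w, hw⟩ := exists_dmap_extChartAt_symm_eq x₀ hq
      (S.xi ((extChartAt 𝓘(ℝ, E) x₀).symm q))
    have h1 := koszul_eta_pullback hcov hS hW hκ hq hw X Y
    have h2 := koszul_eta_pullback hcov hS hW hκ hq hw Y X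
    have h3 : (fun q => g.inner ((extChartAt 𝓘(ℝ, E) x₀).symm q)
          (dmap 𝓘(ℝ, E) (extChartAt 𝓘(ℝ, E) x₀).symm q Y)
          (dmap 𝓘(ℝ, E) (extChartAt 𝓘(ℝ, E) x₀).symm q X)) =
        fun q => g.inner ((extChartAt 𝓘(ℝ, E) x₀).symm q)
          (dmap 𝓘(ℝ, E) (extChartAt 𝓘(ℝ, E) x₀).symm q X)
          (dmap 𝓘(ℝ, E) (extChartAt 𝓘(ℝ, E) x₀).symm q Y) := funext fun q => g.symm _ _ _
    rw [h3, S.inner_phi_left, g.symm _ _ (S.phi _ _),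
      g.symm _ (dmap 𝓘(ℝ, E) (extChartAt 𝓘(ℝ, E) x₀).symm q Y)
        (dmap 𝓘(ℝ, E) (extChartAt 𝓘(ℝ, E) x₀).symm q X)] at h2
    rw [Function.comp_apply]
    -- Skew-symmetrising in `(X, Y)` kills the metric derivatives and the `β` term, leaving `dη = -2
    -- α Φ`.
    linear_combination (1 / 2) * h1 - (1 / 2) * h2
  have hcyc := fun (q : E) (hq : q ∈ (extChartAt 𝓘(ℝ, E) x₀).target) => fderiv_cyclic_sum_eq hW
    (θ := fun Y q => S.eta ((extChartAt 𝓘(ℝ, E) x₀).symm q)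
      (dmap 𝓘(ℝ, E) (extChartAt 𝓘(ℝ, E) x₀).symm q Y))
    (Ψ := fun X Y q => g.inner ((extChartAt 𝓘(ℝ, E) x₀).symm q)
      (S.phi _ (dmap 𝓘(ℝ, E) (extChartAt 𝓘(ℝ, E) x₀).symm q X))
      (dmap 𝓘(ℝ, E) (extChartAt 𝓘(ℝ, E) x₀).symm q Y))
    hθ (hdiff ha) (fun X Y => hdiff (hΨ X Y)) hext hq
  have hdΨ : ∀ X Y Z : E, ContinuousAt (fun q => fderiv ℝ
      (fun q => g.inner ((extChartAt 𝓘(ℝ, E) x₀).symm q)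
        (S.phi _ (dmap 𝓘(ℝ, E) (extChartAt 𝓘(ℝ, E) x₀).symm q X))
        (dmap 𝓘(ℝ, E) (extChartAt 𝓘(ℝ, E) x₀).symm q Y)) q Z) (extChartAt 𝓘(ℝ, E) x₀ x₀) :=
    fun X Y Z => ((((hΨ X Y).contDiffAt (hW.mem_nhds hq₀)).fderiv_right
      (m := 0) (by simp)).continuousAt.clm_apply continuousAt_const)
  obtain ⟨C, hC⟩ := exists_norm_fderiv_le
    (fun X Y => (hdiff (hΨ X Y) _ hq₀).continuousAt)
    (fun X Y Z => ((hdΨ X Y Z).add (hdΨ Y Z X)).add (hdΨ Z X Y))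
    (by filter_upwards [hW.mem_nhds hq₀] with q hq using hcyc q hq) (by
      intro l hl
      ext Z
      obtain ⟨X, Y, h1, h2, h3⟩ := exists_phi_pairing S h4 hq₀ Z
      have h5 := hl X Y Z
      rw [h2, h3, mul_zero, mul_zero, add_zero, add_zero] at h5
      exact (mul_eq_zero.1 h5).resolve_right h1)
  have hz := eventually_eq_zero_of_norm_fderiv_le
    (by filter_upwards [hW.mem_nhds hq₀] with q hq using hdiff ha q hq) hC
    (by rw [Function.comp_apply, extChartAt_to_inv, h0])
  filter_upwards [(continuousAt_extChartAt (I := 𝓘(ℝ, E)) x₀).eventually hz,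
    extChartAt_source_mem_nhds (I := 𝓘(ℝ, E)) x₀] with x hx hxs
  rwa [Function.comp_apply, (extChartAt 𝓘(ℝ, E) x₀).left_inv hxs] at hx

theorem alpha_eq_zero_of_exists [PreconnectedSpace M] (hcov : IsLeviCivita g cov)
    (hS : IsTransSasakian S cov α β) (h4 : 4 ≤ Module.finrank ℝ E) (h0 : ∃ x, α x = 0) (x : M) :
    α x = 0 := by
  have hclopen : IsClopen {x | α x = 0} := by
    refine ⟨isClosed_eq hS.smooth_alpha.continuous continuous_const, ?_⟩
    rw [isOpen_iff_mem_nhds]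
    exact fun x hx => eventually_alpha_eq_zero hcov hS h4 hx
  exact (hclopen.eq_univ h0).ge (Set.mem_univ x)

end Ambient
end DoublyWarpedCR
end

/-! ### The theorem. -/

theorem theorem1 {m a b : ℕ}
    -- the ambient trans-Sasakian manifold, of dimension `2 m + 1`
    {M : Type*} [TopologicalSpace M] [T2Space M]
    [ChartedSpace (EuclideanSpace ℝ (Fin (2 * m + 1))) M] [IsManifold (𝓡 (2 * m + 1)) ∞ M]
    (g : DoublyWarpedCR.RiemMetric (𝓡 (2 * m + 1)) M)
    (S : DoublyWarpedCR.AlmostContactMetric g)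
    (cov : CovariantDerivative (𝓡 (2 * m + 1)) (EuclideanSpace ℝ (Fin (2 * m + 1)))
      (TangentSpace (𝓡 (2 * m + 1)) : M → Type _))
    (hcov : DoublyWarpedCR.IsLeviCivita g cov)
    (α β : M → ℝ) (hS : DoublyWarpedCR.IsTransSasakian S cov α β)
    -- the invariant factor, of dimension `a`
    {N₁ : Type*} [TopologicalSpace N₁] [T2Space N₁] [ConnectedSpace N₁]
    [ChartedSpace (EuclideanSpace ℝ (Fin a)) N₁] [IsManifold (𝓡 a) ∞ N₁]
    (g₁ : DoublyWarpedCR.RiemMetric (𝓡 a) N₁)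
    -- the anti-invariant factor, of dimension `b`
    {N₂ : Type*} [TopologicalSpace N₂] [T2Space N₂] [ConnectedSpace N₂]
    [ChartedSpace (EuclideanSpace ℝ (Fin b)) N₂] [IsManifold (𝓡 b) ∞ N₂]
    (g₂ : DoublyWarpedCR.RiemMetric (𝓡 b) N₂)
    -- the doubly warped product contact CR-submanifold
    (f₁ : N₁ → ℝ) (f₂ : N₂ → ℝ) (ι : N₁ × N₂ → M)
    (hι : DoublyWarpedCR.IsDoublyWarpedContactCR S g₁ g₂ f₁ f₂ ι) :
    -- it is not proper
    ¬ (¬ DoublyWarpedCR.IsConst f₁ ∧ ¬ DoublyWarpedCR.IsConst f₂) ∧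
    -- `ξ` is tangent to one of the two factors
    (DoublyWarpedCR.XiTangentFst (𝓡 a) (𝓡 b) S ι ∨ DoublyWarpedCR.XiTangentSnd (𝓡 a) (𝓡 b) S ι) ∧
    -- `ξ` tangent to the invariant factor
    (DoublyWarpedCR.XiTangentFst (𝓡 a) (𝓡 b) S ι →
      DoublyWarpedCR.IsConst f₂ ∧
      (0 < b →
        (∀ (p : N₁ × N₂) (w : TangentSpace ((𝓡 a).prod (𝓡 b)) p),
          mfderiv ((𝓡 a).prod (𝓡 b)) (𝓡 (2 * m + 1)) ι p w = S.xi (ι p) →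
          mvfderiv ((𝓡 a).prod (𝓡 b)) (fun q : N₁ × N₂ => Real.log (f₁ q.1)) p w = β (ι p)) ∧
        (∃ β₁ : N₁ → ℝ, ContMDiff (𝓡 a) 𝓘(ℝ, ℝ) ∞ β₁ ∧ ∀ p : N₁ × N₂, β (ι p) = β₁ p.1))) ∧
    -- `ξ` tangent to the anti-invariant factor
    (DoublyWarpedCR.XiTangentSnd (𝓡 a) (𝓡 b) S ι →
      DoublyWarpedCR.IsConst f₁ ∧
      (0 < a →
        (∀ p : N₁ × N₂, α (ι p) = 0) ∧
        (∀ (p : N₁ × N₂) (w : TangentSpace ((𝓡 a).prod (𝓡 b)) p),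
          mfderiv ((𝓡 a).prod (𝓡 b)) (𝓡 (2 * m + 1)) ι p w = S.xi (ι p) →
          mvfderiv ((𝓡 a).prod (𝓡 b)) (fun q : N₁ × N₂ => Real.log (f₂ q.2)) p w = β (ι p)) ∧
        (∃ β₂ : N₂ → ℝ, ContMDiff (𝓡 b) 𝓘(ℝ, ℝ) ∞ β₂ ∧ ∀ p : N₁ × N₂, β (ι p) = β₂ p.2) ∧
        (ConnectedSpace M → 5 ≤ 2 * m + 1 →
          (∀ q : M, α q = 0) ∧ DoublyWarpedCR.IsBetaKenmotsu S cov β))) := by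

  have h := hι.isPhiOrthogonal
  have hdich := hι.xiTangentFst_or_xiTangentSnd
  have h₂ : DoublyWarpedCR.XiTangentFst (𝓡 a) (𝓡 b) S ι → DoublyWarpedCR.IsConst f₂ := fun hξ => by
    obtain ⟨y₀⟩ := (inferInstance : Nonempty N₂)
    exact ⟨f₂ y₀, fun y => h.warping_snd_const hcov hS hξ y y₀⟩
  have h₁ : DoublyWarpedCR.XiTangentSnd (𝓡 a) (𝓡 b) S ι → DoublyWarpedCR.IsConst f₁ := fun hξ => by
    obtain ⟨x₀⟩ := (inferInstance : Nonempty N₁)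
    exact ⟨f₁ x₀, fun x => h.swap.warping_snd_const hcov hS (h.xiTangentFst_swap hξ) x x₀⟩
  have hnontriv : ∀ {n : ℕ}, 0 < n → Nontrivial (EuclideanSpace ℝ (Fin n)) := fun {n} hn => by
    have : Nonempty (Fin n) := ⟨⟨0, hn⟩⟩
    infer_instance
  refine ⟨fun hprop => hdich.elim (fun hξ => hprop.2 (h₂ hξ)) (fun hξ => hprop.1 (h₁ hξ)), hdich,
    fun hξ => ⟨h₂ hξ, fun hb => ?_⟩, fun hξ => ⟨h₁ hξ, fun ha => ?_⟩⟩
  · have := hnontriv hb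
    exact ⟨fun p w hw => h.mvfderiv_log_fst_eq hcov hS hξ hw, h.exists_beta_eq hcov hS hξ⟩
  · have := hnontriv ha
    have hα := h.alpha_eq_zero hcov hS hι.invariant hξ
    refine ⟨hα, fun p w hw => h.mvfderiv_log_snd_eq hcov hS hξ hw, ?_, fun hM hdim => ?_⟩
    · obtain ⟨β₂, hβ₂, hβ⟩ := h.swap.exists_beta_eq hcov hS (h.xiTangentFst_swap hξ)
      exact ⟨β₂, hβ₂, fun p => hβ p.swap⟩
    · obtain ⟨p⟩ := (inferInstance : Nonempty (N₁ × N₂))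
      have hzero := DoublyWarpedCR.alpha_eq_zero_of_exists hcov hS
        (by rw [finrank_euclideanSpace_fin]; omega) ⟨ι p, hα p⟩
      -- Once `α` is the zero function, the trans-Sasakian hypothesis is by definition the
      -- `β`-Kenmotsu condition.
      obtain rfl : α = fun _ => 0 := funext hzero
      exact ⟨hzero, hS⟩
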